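/- **Theorem (well-posedness and finite element approximation of the corrector problem).** Let $n\ge 1$, $Y=(0,1)^n$, and let $\lambda,\Lambda>0$, $\delta\in\left(\frac{n}{n+\pi^2},1\right]$. Then there is a constant $C=C(\lambda,\Lambda,\delta,n)>0$ such that the following holds. Let $A\in L^\infty_{\mathrm{per}}(Y;\mathbb R^{n\times n}_{\mathrm{sym}})$ and $b\in L^\infty_{\mathrm{per}}(Y;\mathbb R^n)$ satisfy, a.e. in $\mathbb R^n$, $$\lambda I_n\le A\le \Lambda I_n,\qquad \frac{|A|^2+|b|^2}{(\mathrm{tr}\,A)^2}\le\frac1{n-1+\delta},$$ where $|A|$ is the Frobenius norm. Set $\gamma:=\frac{\mathrm{tr}\,A}{|A|^2+|b|^2}$, $\tilde A:=\gamma A$, $\tilde b:=\gamma b$. Let $r\in L^2_{\mathrm{per}}(Y)$ be the invariant measure, i.e. the solution of $-D^2:(Ar)+\nabla\cdot(br)=0$ with $\int_Y r=1$ in the very weak sense $$\int_Y r\,\big(A:D^2\varphi+b\cdot\nabla\varphi\big)=0\qquad\forall\varphi\in H^2_{\mathrm{per}}(Y),$$ and assume the centering condition $\int_Y r\,b=0$.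 Let the subscript $0$ denote the subspace of functions with mean zero over $Y$, and write $$B_1(\varphi_1,\varphi_2):=\int_Y\Delta\varphi_1\,\big(\tilde A:D^2\varphi_2+\tilde b\cdot\nabla\varphi_2\big),\qquad \varphi_1,\varphi_2\in H^2_{\mathrm{per},0}(Y),$$ $$B_2(v,w):=\int_Y(\nabla\cdot v)\big(\tilde A:Dw+\tilde b\cdot w\big)+\frac12\int_Y\big(Dv-(Dv)^{\mathrm T}\big):\big(Dw-(Dw)^{\mathrm T}\big),\qquad v,w\in H^1_{\mathrm{per},0}(Y;\mathbb R^n).$$ Then for every $j\in\{1,\dots,n\}$: (i) There is a unique $\chi_j\in H^2_{\mathrm{per},0}(Y)$ such that $B_1(\varphi,\chi_j)=-\int_Y\tilde b_j\,\Delta\varphi$ for all $\varphi\in H^2_{\mathrm{per},0}(Y)$. Further, $\chi_j$ is the unique function in $H^2_{\mathrm{per},0}(Y)$ satisfying $-A:D^2\chi_j-b\cdot\nabla\chi_j=b_j$ a.e. in $Y$. (ii) $\nabla\chi_j$ is the unique $\xi_j\in H^1_{\mathrm{per},0}(Y;\mathbb R^n)$ such that $B_2(w,\xi_j)=-\int_Y\tilde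 b_j\,\nabla\cdot w$ for all $w\in H^1_{\mathrm{per},0}(Y;\mathbb R^n)$. Further, for every closed linear subspace $P_h$ of $H^1_{\mathrm{per},0}(Y;\mathbb R^n)$ there is a unique $\xi_{j,h}\in P_h$ such that $B_2(w_h,\xi_{j,h})=-\int_Y\tilde b_j\,\nabla\cdot w_h$ for all $w_h\in P_h$, and $$\|\nabla\chi_j-\xi_{j,h}\|_{H^1(Y;\mathbb R^n)}\le C\inf_{w_h\in P_h}\|D(\nabla\chi_j-w_h)\|_{L^2(Y;\mathbb R^{n\times n})}.$$ -/

import Mathlib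

open MeasureTheory Filter Topology
open scoped ContDiff Matrix

noncomputable section

namespace PeriodicCorrector

/-- The unit cell `Y = (0,1)^n`. -/
def unitCell (n : ℕ) : Set (Fin n → ℝ) :=
  Set.pi Set.univ fun _ => Set.Ioo 0 1

/-- `L²_per(Y)`: a `Y`-periodic function is determined by its restriction to `Y`, and every
`L²` function on `Y` has a unique periodic extension, so the space is the real `L²(Y)`. -/
abbrev L2per (n : ℕ) : Type :=
  Lp ℝ 2 ((volume : Measure (Fin n → ℝ)).restrict (unitCell n))

/-- Smooth `Y`-periodic functions on `ℝⁿ`, the space `C^∞_per(Y)`. -/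
def IsSmoothPeriodic {n : ℕ} (φ : (Fin n → ℝ) → ℝ) : Prop :=
  ContDiff ℝ ∞ φ ∧ ∀ (i : Fin n) (x : Fin n → ℝ), φ (x + Pi.single i 1) = φ x

/-- `g` is the weak derivative `∂ᵢu` of the periodic function `u`:
`∫_Y u ∂ᵢφ = - ∫_Y g φ` for all smooth periodic `φ`. Testing with periodic functions (not only
with functions supported in `Y`) says that the weak derivative of the periodic extension of `u`
to `ℝⁿ` is the periodic extension of `g`. -/
def IsWeakPartial {n : ℕ} (i : Fin n) (u g : L2per n) : Prop :=
  ∀ φ : (Fin n → ℝ) → ℝ, IsSmoothPeriodic φ →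
    ∫ y in unitCell n, u y * fderiv ℝ φ y (Pi.single i 1) = - ∫ y in unitCell n, g y * φ y

open Classical in
/-- The weak derivative `∂ᵢu` in `L²_per(Y)` (and `0` if there is none; it is only used where
it exists). -/
def weakPartial {n : ℕ} (i : Fin n) (u : L2per n) : L2per n :=
  if h : ∃ g, IsWeakPartial i u g then h.choose else 0

/-- `H¹_per(Y)`. -/
def H1per (n : ℕ) : Set (L2per n) :=
  {u | ∀ i, ∃ g, IsWeakPartial i u g}

/-- `H²_per(Y)`. -/
def H2per (n : ℕ) : Set (L2per n) :=
  {u | u ∈ H1per n ∧ ∀ i, weakPartial i u ∈ H1per n}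

/-- `H²_{per,0}(Y)`: functions in `H²_per(Y)` with mean zero. -/
def H2per0 (n : ℕ) : Set (L2per n) :=
  {u | u ∈ H2per n ∧ ∫ y in unitCell n, u y = 0}

/-- `H¹_{per,0}(Y;ℝⁿ)`: vector fields with components in `H¹_per(Y)` of mean zero. -/
def H1per0Vec (n : ℕ) : Set (Fin n → L2per n) :=
  {w | ∀ i, w i ∈ H1per n ∧ ∫ y in unitCell n, w i y = 0}

/-- The gradient `∇u`. -/
def grad {n : ℕ} (u : L2per n) : Fin n → L2per n := fun i => weakPartial i u

/-- The Jacobian `Dw`, with entries `(Dw)ᵢⱼ = ∂ⱼwᵢ`. -/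
def jac {n : ℕ} (w : Fin n → L2per n) (i j : Fin n) : L2per n := weakPartial j (w i)

/-- The divergence `∇·w`. -/
def divg {n : ℕ} (w : Fin n → L2per n) : L2per n := ∑ i, weakPartial i (w i)

/-- The Laplacian `Δu`. -/
def lapl {n : ℕ} (u : L2per n) : L2per n := ∑ i, weakPartial i (weakPartial i u)

/-- `‖Dw‖_{L²(Y;ℝ^{n×n})}`. -/
def jacNorm {n : ℕ} (w : Fin n → L2per n) : ℝ :=
  Real.sqrt (∑ i, ∑ j, ‖jac w i j‖ ^ 2)

/-- `‖w‖_{H¹(Y;ℝⁿ)}`. -/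
def h1Norm {n : ℕ} (w : Fin n → L2per n) : ℝ :=
  Real.sqrt (∑ i, ‖w i‖ ^ 2 + ∑ i, ∑ j, ‖jac w i j‖ ^ 2)

/-- `P` is a closed linear subspace of `H¹_{per,0}(Y;ℝⁿ)`, closed for the `H¹` norm. -/
def IsClosedSubspace {n : ℕ} (P : Submodule ℝ (Fin n → L2per n)) : Prop :=
  (P : Set (Fin n → L2per n)) ⊆ H1per0Vec n ∧
  ∀ (w : ℕ → Fin n → L2per n) (v : Fin n → L2per n), (∀ k, w k ∈ P) → v ∈ H1per0Vec n →
    Tendsto (fun k => h1Norm (w k - v)) atTop (𝓝 0) → v ∈ P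

/-- `f ∈ L^∞_per(Y)`, as a periodic function on `ℝⁿ`. -/
def MemLinftyPer {n : ℕ} (f : (Fin n → ℝ) → ℝ) : Prop :=
  MemLp f ⊤ volume ∧ ∀ i : Fin n, ∀ᵐ x, f (x + Pi.single i 1) = f x

/-- `|A|² + |b|²` at a point, with the Frobenius norm of `A`. -/
def coeffSq {n : ℕ} (A : (Fin n → ℝ) → Matrix (Fin n) (Fin n) ℝ) (b : (Fin n → ℝ) → Fin n → ℝ)
    (x : Fin n → ℝ) : ℝ :=
  ∑ i, ∑ j, A x i j ^ 2 + ∑ i, b x i ^ 2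

/-- The pair `(A,b)` satisfies the Cordes-type setting with ellipticity constants
`lam ≤ Lam` and Cordes parameter `δ`. -/
structure CordesSetting {n : ℕ} (lam Lam δ : ℝ) (A : (Fin n → ℝ) → Matrix (Fin n) (Fin n) ℝ)
    (b : (Fin n → ℝ) → Fin n → ℝ) : Prop where
  A_bounded : ∀ i j, MemLinftyPer fun x => A x i j
  b_bounded : ∀ i, MemLinftyPer fun x => b x i
  A_symm : ∀ᵐ x, (A x).IsSymm
  elliptic : ∀ᵐ x, ∀ ξ : Fin n → ℝ,
    lam * (ξ ⬝ᵥ ξ) ≤ ξ ⬝ᵥ (A x *ᵥ ξ) ∧ ξ ⬝ᵥ (A x *ᵥ ξ) ≤ Lam * (ξ ⬝ᵥ ξ)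
  cordes : ∀ᵐ x, coeffSq A b x / (A x).trace ^ 2 ≤ 1 / ((n : ℝ) - 1 + δ)

/-- The renormalization function `γ = tr(A) / (|A|² + |b|²)`. -/
def renorm {n : ℕ} (A : (Fin n → ℝ) → Matrix (Fin n) (Fin n) ℝ) (b : (Fin n → ℝ) → Fin n → ℝ)
    (x : Fin n → ℝ) : ℝ :=
  (A x).trace / coeffSq A b x

/-- `Ã = γA`. -/
def renormA {n : ℕ} (A : (Fin n → ℝ) → Matrix (Fin n) (Fin n) ℝ) (b : (Fin n → ℝ) → Fin n → ℝ)
    (x : Fin n → ℝ) : Matrix (Fin n) (Fin n) ℝ :=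
  renorm A b x • A x

/-- `b̃ = γb`. -/
def renormb {n : ℕ} (A : (Fin n → ℝ) → Matrix (Fin n) (Fin n) ℝ) (b : (Fin n → ℝ) → Fin n → ℝ)
    (x : Fin n → ℝ) : Fin n → ℝ :=
  renorm A b x • b x

/-- The function `A : Dw + b · w`. -/
def firstOrderOp {n : ℕ} (A : (Fin n → ℝ) → Matrix (Fin n) (Fin n) ℝ)
    (b : (Fin n → ℝ) → Fin n → ℝ) (w : Fin n → L2per n) (x : Fin n → ℝ) : ℝ :=
  ∑ i, ∑ j, A x i j * jac w i j x + ∑ i, b x i * w i x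

/-- The function `A : D²u + b · ∇u`. -/
def secondOrderOp {n : ℕ} (A : (Fin n → ℝ) → Matrix (Fin n) (Fin n) ℝ)
    (b : (Fin n → ℝ) → Fin n → ℝ) (u : L2per n) (x : Fin n → ℝ) : ℝ :=
  ∑ i, ∑ j, A x i j * weakPartial i (weakPartial j u) x + ∑ i, b x i * weakPartial i u x

/-- `r ∈ L²_per(Y)` is the invariant measure: the very weak periodic solution of
`-D²:(Ar) + ∇·(br) = 0` with `∫_Y r = 1`. -/
def IsInvariantMeasure {n : ℕ} (A : (Fin n → ℝ) → Matrix (Fin n) (Fin n) ℝ)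
    (b : (Fin n → ℝ) → Fin n → ℝ) (r : L2per n) : Prop :=
  (∀ φ ∈ H2per n, ∫ y in unitCell n, r y * secondOrderOp A b φ y = 0) ∧
  ∫ y in unitCell n, r y = 1

/-- `B₁(φ₁,φ₂) = ∫_Y Δφ₁ (Ã:D²φ₂ + b̃·∇φ₂)`. -/
def B1 {n : ℕ} (A : (Fin n → ℝ) → Matrix (Fin n) (Fin n) ℝ)
    (b : (Fin n → ℝ) → Fin n → ℝ) (φ₁ φ₂ : L2per n) : ℝ :=
  ∫ y in unitCell n, lapl φ₁ y * secondOrderOp (renormA A b) (renormb A b) φ₂ y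

/-- `B₂(v,w) = ∫_Y (∇·v)(Ã:Dw + b̃·w) + ½ ∫_Y (Dv - (Dv)ᵀ):(Dw - (Dw)ᵀ)`. -/
def B2 {n : ℕ} (A : (Fin n → ℝ) → Matrix (Fin n) (Fin n) ℝ)
    (b : (Fin n → ℝ) → Fin n → ℝ) (v w : Fin n → L2per n) : ℝ :=
  (∫ y in unitCell n, divg v y * firstOrderOp (renormA A b) (renormb A b) w y) +
  (1 / 2) * ∫ y in unitCell n,
    ∑ i, ∑ j, (jac v i j y - jac v j i y) * (jac w i j y - jac w j i y)

/-- `-A:D²χ - b·∇χ = bⱼ` almost everywhere in `Y`. (Periodicity and the zero mean are part of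
membership in `H²_{per,0}(Y)`.) -/
def SolvesCorrector {n : ℕ} (A : (Fin n → ℝ) → Matrix (Fin n) (Fin n) ℝ)
    (b : (Fin n → ℝ) → Fin n → ℝ) (j : Fin n) (χ : L2per n) : Prop :=
  ∀ᵐ y ∂((volume : Measure (Fin n → ℝ)).restrict (unitCell n)),
    -secondOrderOp A b χ y = b y j

/-- `B₁(φ,χ) = -∫_Y b̃ⱼ Δφ` for all `φ ∈ H²_{per,0}(Y)`. -/
def SolvesB1 {n : ℕ} (A : (Fin n → ℝ) → Matrix (Fin n) (Fin n) ℝ)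
    (b : (Fin n → ℝ) → Fin n → ℝ) (j : Fin n) (χ : L2per n) : Prop :=
  ∀ φ ∈ H2per0 n, B1 A b φ χ = - ∫ y in unitCell n, renormb A b y j * lapl φ y

/-- `B₂(w,ξ) = -∫_Y b̃ⱼ ∇·w` for all `w` in the set `S` of test fields. -/
def SolvesB2 {n : ℕ} (A : (Fin n → ℝ) → Matrix (Fin n) (Fin n) ℝ)
    (b : (Fin n → ℝ) → Fin n → ℝ) (j : Fin n) (S : Set (Fin n → L2per n))
    (ξ : Fin n → L2per n) : Prop :=
  ∀ w ∈ S, B2 A b w ξ = - ∫ y in unitCell n, renormb A b y j * divg w y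

end PeriodicCorrector

end

/-!
Writing `L w = Ã : Dw + b̃ · w`, the Cordes-type condition says that the coefficients of
`L - ∇·` have pointwise Euclidean norm at most `√(1 - δ)`. Since the first nonzero eigenvalue of the
torus is `4π²`, this yields Campanato's nearness `‖L w - ∇·w‖ ≤ q ‖Dw‖` with `q < 1`. As
`∫ (∇·v)(∇·w) + ½ ∫ (Dv - Dvᵀ) : (Dw - Dwᵀ) = ∫ Dv : Dw`, the form `B₂` is coercive, and Lax–Milgram
and Céa's lemma apply on every closed subspace. Testing with divergence-free fields shows that the
solution is a gradient `∇χ`.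

Varying `Δφ` over all functions of mean zero, `B₁` determines `L ∇χ + b̃ⱼ` up to a constant. The
function `s = r / γ` is orthogonal to `L ∇φ` for all `φ` by invariance, and to `b̃ⱼ` by the
centering condition. If `s = Δψ` had mean zero, then `B₁(ψ, ψ) = 0` and coercivity would give
`s = 0`; so the mean of `s` is nonzero and the constant vanishes.
-/

noncomputable section

namespace PeriodicCorrector

open UnitAddTorus
open scoped ComplexConjugate

/-! ### Fourier series on the unit cell -/

lemma exists_repr_eq_mul {ι 𝕜 E : Type*} [RCLike 𝕜] [NormedAddCommGroup E] [InnerProductSpace 𝕜 E]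
    (e : HilbertBasis ι 𝕜 E) {m : ι → 𝕜} {C : ℝ} (hm : ∀ k, ‖m k‖ ≤ C) (f : E) :
    ∃ u, ∀ k, e.repr u k = m k * e.repr f k := by
  have hmem : Memℓp (fun k => m k * e.repr f k) 2 :=
    ((lp.memℓp (e.repr f)).norm.const_mul C).mono fun k =>
      (norm_mul _ _).trans_le (mul_le_mul_of_nonneg_right (hm k) (norm_nonneg _))
  exact ⟨e.repr.symm ⟨_, hmem⟩, fun k => by rw [LinearIsometryEquiv.apply_symm_apply]⟩

/-- The Haar probability measure on the circle, the choice of volume under which Mathlib's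
multivariate Fourier series are orthonormal. -/
local instance haarMeasureSpace : MeasureSpace UnitAddCircle := ⟨AddCircle.haarAddCircle⟩

local instance : IsProbabilityMeasure (volume : Measure UnitAddCircle) :=
  inferInstanceAs (IsProbabilityMeasure AddCircle.haarAddCircle)

variable {n : ℕ}

/-- Lebesgue measure on the unit cell. -/
abbrev cellMeasure (n : ℕ) : Measure (Fin n → ℝ) := volume.restrict (unitCell n)

instance (n : ℕ) : IsProbabilityMeasure (cellMeasure n) :=
  ⟨by simp [unitCell, Real.volume_pi_Ioo]⟩

/-- The section of `ℝⁿ → ℝⁿ/ℤⁿ` with values in `(0,1]ⁿ`. -/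
def cellSection (n : ℕ) (x : UnitAddTorus (Fin n)) : Fin n → ℝ :=
  (measurableEquivPiIoc 0 x).1

lemma measurePreserving_cellSection (n : ℕ) :
    MeasurePreserving (cellSection n) volume (cellMeasure n) := by
  have h_cell : cellMeasure n = volume.restrict
      {x : Fin n → ℝ | ∀ i, x i ∈ Set.Ioc ((0 : Fin n → ℝ) i) ((0 : Fin n → ℝ) i + 1)} := by
    have h_box : Set.pi Set.univ (fun _ : Fin n => Set.Ioc (0 : ℝ) 1) =
        {x | ∀ i, x i ∈ Set.Ioc ((0 : Fin n → ℝ) i) ((0 : Fin n → ℝ) i + 1)} := by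
      ext x
      simp
    rw [← h_box]
    exact Measure.restrict_congr_set Measure.pi_Ioo_ae_eq_pi_Ioc
  rw [h_cell]
  exact (measurePreserving_subtype_coe (MeasurableSet.univ_pi' fun _ => measurableSet_Ioc)).comp
    (measurePreserving_equivPiIoc (0 : Fin n → ℝ))

/-- The character `x ↦ exp(2πi k·x)`. -/
def expChar (k : Fin n → ℤ) (x : Fin n → ℝ) : ℂ :=
  mFourier k fun i => (x i : UnitAddCircle)

lemma expChar_cellSection (k : Fin n → ℤ) (x : UnitAddTorus (Fin n)) :
    expChar k (cellSection n x) = mFourier k x :=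
  congrArg (mFourier k) ((measurableEquivPiIoc (0 : Fin n → ℝ)).symm_apply_apply x)

lemma expChar_eq_exp (k : Fin n → ℤ) (x : Fin n → ℝ) :
    expChar k x = Complex.exp (2 * Real.pi * Complex.I * ∑ i, (k i : ℂ) * (x i : ℂ)) := by
  rw [Finset.mul_sum, Complex.exp_sum]
  simp only [expChar, mFourier, ContinuousMap.coe_mk, fourier_coe_apply]
  refine Finset.prod_congr rfl fun i _ => ?_
  congr 1
  push_cast
  ring

lemma expChar_neg (k : Fin n → ℤ) (x : Fin n → ℝ) : expChar (-k) x = conj (expChar k x) :=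
  mFourier_neg

lemma expChar_zero (x : Fin n → ℝ) : expChar 0 x = 1 := by
  simp [expChar, mFourier_zero]

lemma contDiff_expChar (k : Fin n → ℤ) : ContDiff ℝ ∞ (expChar k) := by
  have h : expChar k = fun x : Fin n → ℝ =>
      Complex.exp (2 * Real.pi * Complex.I * ∑ i, (k i : ℂ) * Complex.ofRealCLM (x i)) :=
    funext fun x => expChar_eq_exp k x
  rw [h]
  fun_prop

lemma norm_expChar (k : Fin n → ℤ) (x : Fin n → ℝ) : ‖expChar k x‖ = 1 := by
  simp only [expChar, mFourier, fourier_apply, ContinuousMap.coe_mk, norm_prod, Circle.norm_coe,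
    Finset.prod_const_one]

lemma memLp_expChar (k : Fin n → ℤ) : MemLp (expChar k) 2 (cellMeasure n) :=
  MemLp.of_bound (contDiff_expChar k).continuous.aestronglyMeasurable 1
    (ae_of_all _ fun x => (norm_expChar k x).le)

/-- The complex space `L²(Y;ℂ)`. -/
abbrev ComplexL2 (n : ℕ) : Type := Lp ℂ 2 (cellMeasure n)

/-- The character `exp(2πi k·x)` as an element of `L²(Y;ℂ)`. -/
def expLp (k : Fin n → ℤ) : ComplexL2 n := (memLp_expChar k).toLp _

/-- The isometry `L²(Y;ℂ) → L²(ℝⁿ/ℤⁿ;ℂ)`, through which Mathlib's Fourier basis of the torus is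
transported to the cell. -/
def toTorus (n : ℕ) : ComplexL2 n →ₗᵢ[ℂ] Lp ℂ 2 (volume : Measure (UnitAddTorus (Fin n))) :=
  Lp.compMeasurePreservingₗᵢ ℂ (cellSection n) (measurePreserving_cellSection n)

lemma toTorus_expLp (k : Fin n → ℤ) : toTorus n (expLp k) = mFourierLp 2 k := by
  refine Lp.ext ?_
  have h_comp := (measurePreserving_cellSection n).quasiMeasurePreserving.ae_eq_comp
    (memLp_expChar k).coeFn_toLp
  filter_upwards [Lp.coeFn_compMeasurePreserving (expLp k) (measurePreserving_cellSection n),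
    h_comp, coeFn_mFourierLp 2 k] with x h₁ h₂ h₃
  exact h₁.trans (h₂.trans ((expChar_cellSection k x).trans h₃.symm))

lemma orthonormal_expLp (n : ℕ) : Orthonormal ℂ (expLp (n := n)) := by
  rw [← LinearIsometry.orthonormal_comp_iff (toTorus n)]
  convert orthonormal_mFourier (d := Fin n) using 1
  exact funext toTorus_expLp

/-- The Fourier basis of `L²(Y;ℂ)`. -/
def cellBasis (n : ℕ) : HilbertBasis (Fin n → ℤ) ℂ (ComplexL2 n) :=
  HilbertBasis.mkOfOrthogonalEqBot (orthonormal_expLp n) <| by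
    refine (Submodule.eq_bot_iff _).2 fun f hf => (toTorus n).injective ?_
    rw [map_zero, ← map_eq_zero_iff _ mFourierBasis.repr.injective]
    ext k
    rw [HilbertBasis.repr_apply_apply, coe_mFourierBasis, ← toTorus_expLp,
      LinearIsometry.inner_map_map]
    exact (Submodule.mem_orthogonal _ _).1 hf _ (Submodule.subset_span ⟨k, rfl⟩)

lemma cellBasis_repr (f : ComplexL2 n) (k : Fin n → ℤ) :
    (cellBasis n).repr f k = ∫ x in unitCell n, expChar (-k) x * f x := by
  rw [HilbertBasis.repr_apply_apply, cellBasis, HilbertBasis.coe_mkOfOrthogonalEqBot,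
    L2.inner_def]
  refine integral_congr_ae ?_
  filter_upwards [(memLp_expChar k).coeFn_toLp] with x hx
  rw [expLp, hx, RCLike.inner_apply, expChar_neg, mul_comm]

lemma cellBasis_repr_star (f : ComplexL2 n) (k : Fin n → ℤ) :
    (cellBasis n).repr (star f) k = conj ((cellBasis n).repr f (-k)) := by
  rw [cellBasis_repr, cellBasis_repr, ← integral_conj]
  refine integral_congr_ae ?_
  filter_upwards [Lp.coeFn_star f] with x hx
  rw [hx, map_mul, ← expChar_neg, neg_neg]
  rfl

/-! ### Fourier coefficients of real functions -/

/-- The inclusion of `L²(Y)` in `L²(Y;ℂ)`. -/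
def complexify (n : ℕ) : L2per n →L[ℝ] ComplexL2 n := Complex.ofRealCLM.compLpL 2 (cellMeasure n)

lemma coeFn_complexify (u : L2per n) : complexify n u =ᵐ[cellMeasure n] fun x => (u x : ℂ) :=
  Complex.ofRealCLM.coeFn_compLpL u

lemma star_complexify (u : L2per n) : star (complexify n u) = complexify n u := by
  refine Lp.ext ?_
  filter_upwards [Lp.coeFn_star (complexify n u), coeFn_complexify u] with x h_star hu
  rw [h_star, Pi.star_apply, hu]
  exact Complex.conj_ofReal _

lemma exists_complexify_eq {f : ComplexL2 n} (hf : star f = f) : ∃ u, complexify n u = f := by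
  refine ⟨Complex.reCLM.compLpL 2 (cellMeasure n) f, Lp.ext ?_⟩
  have h_real := Lp.coeFn_star f
  rw [hf] at h_real
  filter_upwards [coeFn_complexify (Complex.reCLM.compLpL 2 (cellMeasure n) f),
    Complex.reCLM.coeFn_compLpL (p := 2) f, h_real] with x h₁ h₂ h₃
  rw [h₁, h₂]
  exact Complex.conj_eq_iff_re.1 h₃.symm

lemma inner_complexify (u v : L2per n) :
    inner ℂ (complexify n u) (complexify n v) = ((inner ℝ u v : ℝ) : ℂ) := by
  rw [L2.inner_def, L2.inner_def, ← integral_complex_ofReal]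
  refine integral_congr_ae ?_
  filter_upwards [coeFn_complexify u, coeFn_complexify v] with x hu hv
  rw [hu, hv]
  simp

/-- The Fourier coefficients of a real periodic function. -/
def cellFourierCoeff (u : L2per n) (k : Fin n → ℤ) : ℂ := (cellBasis n).repr (complexify n u) k

lemma cellFourierCoeff_eq_integral (u : L2per n) (k : Fin n → ℤ) :
    cellFourierCoeff u k = ∫ x in unitCell n, expChar (-k) x * (u x : ℂ) := by
  rw [cellFourierCoeff, cellBasis_repr]
  refine integral_congr_ae ?_
  filter_upwards [coeFn_complexify u] with x hx
  rw [hx]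

lemma cellFourierCoeff_add (u v : L2per n) (k : Fin n → ℤ) :
    cellFourierCoeff (u + v) k = cellFourierCoeff u k + cellFourierCoeff v k := by
  simp [cellFourierCoeff]

lemma cellFourierCoeff_sub (u v : L2per n) (k : Fin n → ℤ) :
    cellFourierCoeff (u - v) k = cellFourierCoeff u k - cellFourierCoeff v k := by
  simp [cellFourierCoeff]

lemma cellFourierCoeff_smul (c : ℝ) (u : L2per n) (k : Fin n → ℤ) :
    cellFourierCoeff (c • u) k = c * cellFourierCoeff u k := by
  have h : complexify n (c • u) = (c : ℂ) • complexify n u := map_smul _ _ _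
  rw [cellFourierCoeff, h, map_smul]
  rfl

lemma cellFourierCoeff_sum {ι : Type*} (s : Finset ι) (u : ι → L2per n) (k : Fin n → ℤ) :
    cellFourierCoeff (∑ i ∈ s, u i) k = ∑ i ∈ s, cellFourierCoeff (u i) k := by
  simp only [cellFourierCoeff, map_sum, lp.coeFn_sum]
  exact Finset.sum_apply _ _ _

lemma cellFourierCoeff_neg_index (u : L2per n) (k : Fin n → ℤ) :
    cellFourierCoeff u (-k) = conj (cellFourierCoeff u k) := by
  rw [cellFourierCoeff, cellFourierCoeff, ← star_complexify u, cellBasis_repr_star, neg_neg,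
    star_complexify]

lemma hasSum_conj_cellFourierCoeff_mul (u v : L2per n) :
    HasSum (fun k => conj (cellFourierCoeff u k) * cellFourierCoeff v k)
      ((inner ℝ u v : ℝ) : ℂ) := by
  rw [← inner_complexify]
  refine ((cellBasis n).hasSum_inner_mul_inner _ _).congr_fun fun k => ?_
  rw [cellFourierCoeff, cellFourierCoeff, HilbertBasis.repr_apply_apply,
    HilbertBasis.repr_apply_apply, inner_conj_symm]

lemma hasSum_norm_cellFourierCoeff_sq (u : L2per n) :
    HasSum (fun k => ‖cellFourierCoeff u k‖ ^ 2) (‖u‖ ^ 2) := by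
  have h := hasSum_conj_cellFourierCoeff_mul u u
  simp only [real_inner_self_eq_norm_sq, Complex.conj_mul'] at h
  exact_mod_cast h

lemma cellFourierCoeff_injective : Function.Injective (cellFourierCoeff (n := n)) := by
  intro u v h
  have h_diff := hasSum_norm_cellFourierCoeff_sq (u - v)
  simp only [cellFourierCoeff_sub, h, sub_self, norm_zero, zero_pow two_ne_zero] at h_diff
  exact sub_eq_zero.1 (norm_eq_zero.1 (pow_eq_zero_iff two_ne_zero |>.1
    (h_diff.unique hasSum_zero)))

lemma integral_eq_cellFourierCoeff_zero (u : L2per n) :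
    ((∫ y in unitCell n, u y : ℝ) : ℂ) = cellFourierCoeff u 0 := by
  rw [cellFourierCoeff_eq_integral, ← integral_complex_ofReal]
  simp [expChar_zero]

lemma integral_eq_zero_iff_cellFourierCoeff (u : L2per n) :
    ∫ y in unitCell n, u y = 0 ↔ cellFourierCoeff u 0 = 0 := by
  rw [← integral_eq_cellFourierCoeff_zero, Complex.ofReal_eq_zero]

lemma exists_cellFourierCoeff_eq_mul {m : (Fin n → ℤ) → ℂ} {C : ℝ} (hC : ∀ k, ‖m k‖ ≤ C)
    (hm : ∀ k, m (-k) = conj (m k)) (f : L2per n) :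
    ∃ u : L2per n, ∀ k, cellFourierCoeff u k = m k * cellFourierCoeff f k := by
  obtain ⟨U, hU⟩ := exists_repr_eq_mul (cellBasis n) hC (complexify n f)
  have h_real : star U = U := (cellBasis n).repr.injective <| lp.ext <| funext fun k => by
    have h_symm := cellFourierCoeff_neg_index f k
    rw [cellFourierCoeff, cellFourierCoeff] at h_symm
    rw [cellBasis_repr_star, hU, hU, h_symm, hm, map_mul, Complex.conj_conj, Complex.conj_conj]
  obtain ⟨u, rfl⟩ := exists_complexify_eq h_real
  exact ⟨u, hU⟩

/-! ### Smooth periodic functions -/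

lemma unitCell_ae_eq_Icc : unitCell n =ᵐ[volume] Set.Icc (0 : Fin n → ℝ) 1 :=
  Measure.univ_pi_Ioo_ae_eq_Icc

lemma memLp_of_continuous {f : (Fin n → ℝ) → ℝ} (hf : Continuous f) :
    MemLp f 2 (cellMeasure n) := by
  obtain ⟨C, hC⟩ := (isCompact_Icc (a := (0 : Fin n → ℝ)) (b := 1)).exists_bound_of_continuousOn
    hf.continuousOn
  refine MemLp.of_bound hf.aestronglyMeasurable C ?_
  rw [cellMeasure, Measure.restrict_congr_set unitCell_ae_eq_Icc]
  exact ae_restrict_of_forall_mem measurableSet_Icc hC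

lemma IsSmoothPeriodic.mul {φ ψ : (Fin n → ℝ) → ℝ} (hφ : IsSmoothPeriodic φ)
    (hψ : IsSmoothPeriodic ψ) : IsSmoothPeriodic fun x => φ x * ψ x :=
  ⟨hφ.1.mul hψ.1, fun i x => by simp only [hφ.2, hψ.2]⟩

lemma IsSmoothPeriodic.continuous_fderiv_apply {φ : (Fin n → ℝ) → ℝ} (hφ : IsSmoothPeriodic φ)
    (v : Fin n → ℝ) : Continuous fun x => fderiv ℝ φ x v :=
  (hφ.1.continuous_fderiv (by simp)).clm_apply continuous_const

lemma integral_Icc_fderiv_single {m : ℕ} {φ : (Fin (m + 1) → ℝ) → ℝ} (hφ : ContDiff ℝ 1 φ)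
    (i : Fin (m + 1)) :
    ∫ y in Set.Icc 0 1, fderiv ℝ φ y (Pi.single i 1) =
      (∫ y in Set.Icc (0 : Fin m → ℝ) 1, φ (i.insertNth 1 y)) -
        ∫ y in Set.Icc (0 : Fin m → ℝ) 1, φ (i.insertNth 0 y) := by
  have h_divergence := integral_divergence_of_hasFDerivAt_off_countable' (0 : Fin (m + 1) → ℝ) 1
    (fun _ => zero_le_one) (Pi.single i φ) (Pi.single i (fderiv ℝ φ)) ∅ Set.countable_empty
    (fun j => ?_) (fun x _ j => ?_) ?_
  · have h_sum : ∀ x, ∑ j, (Pi.single i (fderiv ℝ φ) : Fin (m + 1) → _) j x (Pi.single j 1) =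
        fderiv ℝ φ x (Pi.single i 1) := fun x => by
      rw [Finset.sum_eq_single i (fun j _ hj => by simp [hj]) (by simp), Pi.single_eq_same]
    simp only [h_sum] at h_divergence
    rw [h_divergence, Finset.sum_eq_single i (fun j _ hj => by simp [hj]) (by simp)]
    simp only [Pi.single_eq_same]
    rfl
  · rcases eq_or_ne j i with rfl | hj
    · simpa using hφ.continuous.continuousOn
    · rw [Pi.single_eq_of_ne hj]
      exact continuousOn_const
  · rcases eq_or_ne j i with rfl | hj
    · simpa using (hφ.differentiable (by simp) x).hasFDerivAt
    · rw [Pi.single_eq_of_ne hj, Pi.single_eq_of_ne hj]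
      exact hasFDerivAt_const 0 x
  · refine Continuous.integrableOn_Icc (continuous_finsetSum _ fun j _ => ?_)
    rcases eq_or_ne j i with rfl | hj
    · simpa using (hφ.continuous_fderiv (by simp)).clm_apply continuous_const
    · simpa [hj] using continuous_const

lemma IsSmoothPeriodic.integral_fderiv {φ : (Fin n → ℝ) → ℝ} (hφ : IsSmoothPeriodic φ)
    (i : Fin n) : ∫ y in unitCell n, fderiv ℝ φ y (Pi.single i 1) = 0 := by
  obtain ⟨m, rfl⟩ := Nat.exists_eq_add_one.2 i.pos
  have h_faces (y : Fin m → ℝ) :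
      (i.insertNth 1 y : Fin (m + 1) → ℝ) = i.insertNth 0 y + Pi.single i 1 := by
    ext l
    rcases Fin.eq_self_or_eq_succAbove i l with rfl | ⟨l, rfl⟩ <;> simp
  rw [setIntegral_congr_set unitCell_ae_eq_Icc, integral_Icc_fderiv_single (hφ.1.of_le (by simp))]
  simp only [h_faces, hφ.2, sub_self]

lemma IsSmoothPeriodic.integral_mul_fderiv {φ ψ : (Fin n → ℝ) → ℝ} (hφ : IsSmoothPeriodic φ)
    (hψ : IsSmoothPeriodic ψ) (i : Fin n) :
    ∫ y in unitCell n, φ y * fderiv ℝ ψ y (Pi.single i 1) =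
      -∫ y in unitCell n, fderiv ℝ φ y (Pi.single i 1) * ψ y := by
  have h_int {f g : (Fin n → ℝ) → ℝ} (hf : Continuous f) (hg : Continuous g) :
      Integrable (fun x => f x * g x) (cellMeasure n) :=
    (memLp_of_continuous (hf.mul hg)).integrable one_le_two
  have h_leibniz (x : Fin n → ℝ) : fderiv ℝ (fun x => φ x * ψ x) x (Pi.single i 1) =
      φ x * fderiv ℝ ψ x (Pi.single i 1) + fderiv ℝ φ x (Pi.single i 1) * ψ x := by
    rw [fderiv_fun_mul (hφ.1.differentiable (by simp) x) (hψ.1.differentiable (by simp) x)]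
    simp [mul_comm]
  have h_zero := (hφ.mul hψ).integral_fderiv i
  simp only [h_leibniz] at h_zero
  rw [integral_add (h_int hφ.1.continuous (hψ.continuous_fderiv_apply _))
    (h_int (hφ.continuous_fderiv_apply _) hψ.1.continuous)] at h_zero
  exact eq_neg_of_add_eq_zero_left h_zero

lemma IsSmoothPeriodic.isWeakPartial {φ : (Fin n → ℝ) → ℝ} (hφ : IsSmoothPeriodic φ) (i : Fin n) :
    IsWeakPartial i ((memLp_of_continuous hφ.1.continuous).toLp φ)
      ((memLp_of_continuous (hφ.continuous_fderiv_apply (Pi.single i 1))).toLp _) := by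
  intro ψ hψ
  have h_toLp {f : (Fin n → ℝ) → ℝ} (hf : MemLp f 2 (cellMeasure n)) (g : (Fin n → ℝ) → ℝ) :
      ∫ y in unitCell n, hf.toLp f y * g y = ∫ y in unitCell n, f y * g y :=
    integral_congr_ae (hf.coeFn_toLp.mul .rfl)
  rw [h_toLp, h_toLp, hφ.integral_mul_fderiv hψ]

/-! ### Weak derivatives as Fourier multipliers -/

/-- The Fourier symbol `2πi kᵢ` of `∂ᵢ`. -/
def derivSymbol (i : Fin n) (k : Fin n → ℤ) : ℂ := 2 * Real.pi * Complex.I * k i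

lemma derivSymbol_neg (i : Fin n) (k : Fin n → ℤ) : derivSymbol i (-k) = -derivSymbol i k := by
  simp [derivSymbol]

lemma conj_derivSymbol (i : Fin n) (k : Fin n → ℤ) :
    conj (derivSymbol i k) = -derivSymbol i k := by
  rw [derivSymbol, map_mul, map_mul, map_mul, Complex.conj_I, Complex.conj_ofReal, map_intCast,
    map_ofNat]
  ring

lemma expChar_add_smul_single (k : Fin n → ℤ) (x : Fin n → ℝ) (i : Fin n) (t : ℝ) :
    expChar k (x + t • Pi.single i 1) = expChar k x * Complex.exp (derivSymbol i k * t) := by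
  have h_phase : ∑ j, (k j : ℂ) * ((x + t • (Pi.single i 1 : Fin n → ℝ)) j : ℂ) =
      ∑ j, (k j : ℂ) * (x j : ℂ) + k i * t := by
    simp [mul_add, Finset.sum_add_distrib, Pi.single_apply, apply_ite Complex.ofReal]
  rw [expChar_eq_exp, expChar_eq_exp, ← Complex.exp_add, h_phase, derivSymbol]
  congr 1
  ring

lemma fderiv_expChar (k : Fin n → ℤ) (x : Fin n → ℝ) (i : Fin n) :
    fderiv ℝ (expChar k) x (Pi.single i 1) = derivSymbol i k * expChar k x := by
  rw [← ((contDiff_expChar k).differentiable (by simp) x).lineDeriv_eq_fderiv, lineDeriv]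
  simp only [expChar_add_smul_single]
  have h_exp : HasDerivAt (fun t : ℝ => Complex.exp (derivSymbol i k * t)) (derivSymbol i k) 0 := by
    simpa using ((Complex.ofRealCLM.hasDerivAt (x := 0)).const_mul (derivSymbol i k)).cexp
  rw [(h_exp.const_mul _).deriv, mul_comm]

lemma expChar_periodic (k : Fin n → ℤ) (i : Fin n) (x : Fin n → ℝ) :
    expChar k (x + Pi.single i 1) = expChar k x := by
  unfold expChar
  congr 1
  funext j
  rcases eq_or_ne j i with rfl | h
  · simp
  · simp [h]

lemma isSmoothPeriodic_clm_expChar (L : ℂ →L[ℝ] ℝ) (k : Fin n → ℤ) :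
    IsSmoothPeriodic fun x => L (expChar k x) :=
  ⟨L.contDiff.comp (contDiff_expChar k), fun i x => by simp only [expChar_periodic]⟩

lemma fderiv_clm_expChar (L : ℂ →L[ℝ] ℝ) (k : Fin n → ℤ) (x : Fin n → ℝ) (i : Fin n) :
    fderiv ℝ (fun y => L (expChar k y)) x (Pi.single i 1) = L (derivSymbol i k * expChar k x) := by
  have h := L.hasFDerivAt.comp x ((contDiff_expChar k).differentiable (by simp) x).hasFDerivAt
  rw [← fderiv_expChar, HasFDerivAt.fderiv (f := fun y => L (expChar k y)) h]
  rfl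

lemma integral_mul_clm_expChar (L : ℂ →L[ℝ] ℝ) (u : L2per n) (z : ℂ) (k : Fin n → ℤ) :
    ∫ y in unitCell n, u y * L (z * expChar (-k) y) = L (z * cellFourierCoeff u k) := by
  have h_int : Integrable (fun x => expChar (-k) x * (u x : ℂ)) (cellMeasure n) :=
    ((Lp.memLp u).integrable one_le_two).ofReal.bdd_mul
      (contDiff_expChar (-k)).continuous.aestronglyMeasurable
      (ae_of_all _ fun x => (norm_expChar (-k) x).le)
  have h_smul (r : ℝ) (w : ℂ) : r * L w = L (w * r) := by
    rw [mul_comm w, ← Complex.real_smul, map_smul, smul_eq_mul]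
  simp only [h_smul, mul_assoc]
  rw [L.integral_comp_comm (h_int.const_mul z), integral_const_mul, cellFourierCoeff_eq_integral]

lemma IsWeakPartial.cellFourierCoeff_eq {i : Fin n} {u g : L2per n} (h : IsWeakPartial i u g)
    (k : Fin n → ℤ) : cellFourierCoeff g k = derivSymbol i k * cellFourierCoeff u k := by
  have h_test (L : ℂ →L[ℝ] ℝ) :
      L (cellFourierCoeff g k) = L (derivSymbol i k * cellFourierCoeff u k) := by
    have hL := h _ (isSmoothPeriodic_clm_expChar L (-k))
    have hg := integral_mul_clm_expChar L g 1 k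
    simp only [one_mul] at hg
    simp only [fderiv_clm_expChar, integral_mul_clm_expChar, hg, derivSymbol_neg] at hL
    rw [← neg_inj, ← hL, neg_mul, map_neg]
  exact Complex.ext (h_test Complex.reCLM) (h_test Complex.imCLM)

lemma integral_mul_eq_inner {α : Type*} {mα : MeasurableSpace α} {μ : Measure α}
    (u v : Lp ℝ 2 μ) : ∫ y, u y * v y ∂μ = inner ℝ u v := by
  rw [L2.inner_def]
  exact integral_congr_ae (ae_of_all _ fun x => mul_comm _ _)

lemma isWeakPartial_iff {i : Fin n} {u g : L2per n} :
    IsWeakPartial i u g ↔ ∀ k, cellFourierCoeff g k = derivSymbol i k * cellFourierCoeff u k := by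
  refine ⟨fun h => h.cellFourierCoeff_eq, fun h φ hφ => ?_⟩
  have h_toLp {f : (Fin n → ℝ) → ℝ} (hf : MemLp f 2 (cellMeasure n)) (v : L2per n) :
      ∫ y in unitCell n, v y * f y = inner ℝ v (hf.toLp f) := by
    rw [← integral_mul_eq_inner]
    exact integral_congr_ae (.mul .rfl hf.coeFn_toLp.symm)
  rw [h_toLp (memLp_of_continuous (hφ.continuous_fderiv_apply _)),
    h_toLp (memLp_of_continuous hφ.1.continuous)]
  refine Complex.ofReal_injective ((hasSum_conj_cellFourierCoeff_mul _ _).unique ?_)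
  push_cast
  refine (hasSum_conj_cellFourierCoeff_mul _ _).neg.congr_fun fun k => ?_
  rw [(hφ.isWeakPartial i).cellFourierCoeff_eq, h k, map_mul, conj_derivSymbol]
  ring

/-! ### Periodic Sobolev spaces -/

lemma isWeakPartial_weakPartial {u : L2per n} (hu : u ∈ H1per n) (i : Fin n) :
    IsWeakPartial i u (weakPartial i u) := by
  rw [weakPartial, dif_pos (hu i)]
  exact (hu i).choose_spec

lemma cellFourierCoeff_weakPartial {u : L2per n} (hu : u ∈ H1per n) (i : Fin n) (k : Fin n → ℤ) :
    cellFourierCoeff (weakPartial i u) k = derivSymbol i k * cellFourierCoeff u k :=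
  (isWeakPartial_weakPartial hu i).cellFourierCoeff_eq k

lemma IsWeakPartial.weakPartial_eq {i : Fin n} {u g : L2per n} (h : IsWeakPartial i u g) :
    weakPartial i u = g := by
  have h_ex : ∃ g, IsWeakPartial i u g := ⟨g, h⟩
  rw [weakPartial, dif_pos h_ex]
  exact cellFourierCoeff_injective <| funext fun k => by
    rw [h_ex.choose_spec.cellFourierCoeff_eq, h.cellFourierCoeff_eq]

lemma IsWeakPartial.add {i : Fin n} {u v g h : L2per n} (hu : IsWeakPartial i u g)
    (hv : IsWeakPartial i v h) : IsWeakPartial i (u + v) (g + h) :=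
  isWeakPartial_iff.2 fun k => by
    rw [cellFourierCoeff_add, cellFourierCoeff_add, hu.cellFourierCoeff_eq, hv.cellFourierCoeff_eq,
      mul_add]

lemma IsWeakPartial.smul {i : Fin n} {u g : L2per n} (c : ℝ) (hu : IsWeakPartial i u g) :
    IsWeakPartial i (c • u) (c • g) :=
  isWeakPartial_iff.2 fun k => by
    rw [cellFourierCoeff_smul, cellFourierCoeff_smul, hu.cellFourierCoeff_eq, mul_left_comm]

lemma weakPartial_add {u v : L2per n} (hu : u ∈ H1per n) (hv : v ∈ H1per n) (i : Fin n) :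
    weakPartial i (u + v) = weakPartial i u + weakPartial i v :=
  ((isWeakPartial_weakPartial hu i).add (isWeakPartial_weakPartial hv i)).weakPartial_eq

lemma weakPartial_smul (c : ℝ) {u : L2per n} (hu : u ∈ H1per n) (i : Fin n) :
    weakPartial i (c • u) = c • weakPartial i u :=
  ((isWeakPartial_weakPartial hu i).smul c).weakPartial_eq

lemma integral_weakPartial {u : L2per n} (hu : u ∈ H1per n) (i : Fin n) :
    ∫ y in unitCell n, weakPartial i u y = 0 := by
  rw [integral_eq_zero_iff_cellFourierCoeff, cellFourierCoeff_weakPartial hu]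
  simp [derivSymbol]

lemma weakPartial_comm {u : L2per n} (hu : u ∈ H2per n) (i j : Fin n) :
    weakPartial i (weakPartial j u) = weakPartial j (weakPartial i u) :=
  cellFourierCoeff_injective <| funext fun k => by
    rw [cellFourierCoeff_weakPartial (hu.2 j), cellFourierCoeff_weakPartial (hu.2 i),
      cellFourierCoeff_weakPartial hu.1, cellFourierCoeff_weakPartial hu.1, mul_left_comm]

lemma inner_weakPartial_comm {u v : L2per n} (hu : u ∈ H1per n) (hv : v ∈ H1per n) (i j : Fin n) :
    inner ℝ (weakPartial j u) (weakPartial i v) =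
      inner ℝ (weakPartial i u) (weakPartial j v) := by
  refine Complex.ofReal_injective ((hasSum_conj_cellFourierCoeff_mul _ _).unique ?_)
  refine (hasSum_conj_cellFourierCoeff_mul _ _).congr_fun fun k => ?_
  simp only [cellFourierCoeff_weakPartial hu, cellFourierCoeff_weakPartial hv, map_mul,
    conj_derivSymbol]
  ring

/-- The vector fields in `H¹_{per,0}(Y;ℝⁿ)` as a subspace of `L²_per(Y;ℝⁿ)`. -/
def h1per0Vec (n : ℕ) : Submodule ℝ (Fin n → L2per n) where
  carrier := H1per0Vec n
  zero_mem' i := by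
    refine ⟨fun j => ⟨0, isWeakPartial_iff.2 fun k => ?_⟩,
      (integral_eq_zero_iff_cellFourierCoeff _).2 ?_⟩ <;> simp [cellFourierCoeff]
  add_mem' {v w} hv hw i := by
    refine ⟨fun j => ⟨_, (isWeakPartial_weakPartial (hv i).1 j).add
      (isWeakPartial_weakPartial (hw i).1 j)⟩, (integral_eq_zero_iff_cellFourierCoeff _).2 ?_⟩
    rw [Pi.add_apply, cellFourierCoeff_add, (integral_eq_zero_iff_cellFourierCoeff _).1 (hv i).2,
      (integral_eq_zero_iff_cellFourierCoeff _).1 (hw i).2, add_zero]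
  smul_mem' c w hw i := by
    refine ⟨fun j => ⟨_, (isWeakPartial_weakPartial (hw i).1 j).smul c⟩,
      (integral_eq_zero_iff_cellFourierCoeff _).2 ?_⟩
    rw [Pi.smul_apply, cellFourierCoeff_smul, (integral_eq_zero_iff_cellFourierCoeff _).1 (hw i).2,
      mul_zero]

lemma integral_divg {w : Fin n → L2per n} (hw : w ∈ H1per0Vec n) :
    ∫ y in unitCell n, divg w y = 0 := by
  rw [integral_eq_zero_iff_cellFourierCoeff, divg, cellFourierCoeff_sum]
  exact Finset.sum_eq_zero fun i _ =>
    (integral_eq_zero_iff_cellFourierCoeff _).1 (integral_weakPartial (hw i).1 i)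

-- Integrating by parts twice turns `∫ ∂ᵢvᵢ ∂ⱼwⱼ` into `∫ ∂ⱼvᵢ ∂ᵢwⱼ`.
lemma inner_divg_add_inner_skew {v w : Fin n → L2per n} (hv : v ∈ H1per0Vec n)
    (hw : w ∈ H1per0Vec n) :
    inner ℝ (divg v) (divg w) + (1 / 2) * ∑ i, ∑ j,
      inner ℝ (jac v i j - jac v j i) (jac w i j - jac w j i) =
      ∑ i, ∑ j, inner ℝ (jac v i j) (jac w i j) := by
  have h_div : inner ℝ (divg v) (divg w) = ∑ i, ∑ j, inner ℝ (jac v i j) (jac w j i) := by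
    simp only [divg, sum_inner, inner_sum, jac]
    rw [Finset.sum_comm]
    exact Finset.sum_congr rfl fun i _ => Finset.sum_congr rfl fun j _ =>
      (inner_weakPartial_comm (hv _).1 (hw _).1 _ _).symm
  have h_swap : ∑ i, ∑ j, inner ℝ (jac v j i) (jac w j i) =
      ∑ i, ∑ j, inner ℝ (jac v i j) (jac w i j) := Finset.sum_comm
  have h_swap' : ∑ i, ∑ j, inner ℝ (jac v j i) (jac w i j) =
      ∑ i, ∑ j, inner ℝ (jac v i j) (jac w j i) := Finset.sum_comm
  simp only [inner_sub_left, inner_sub_right, Finset.sum_sub_distrib, h_div, h_swap, h_swap']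
  ring

lemma norm_derivSymbol (i : Fin n) (k : Fin n → ℤ) :
    ‖derivSymbol i k‖ = 2 * Real.pi * |(k i : ℝ)| := by
  rw [derivSymbol, norm_mul, norm_mul, norm_mul, Complex.norm_I, Complex.norm_intCast,
    Complex.norm_real, Real.norm_of_nonneg Real.pi_pos.le, Complex.norm_ofNat, mul_one]

lemma le_sum_norm_derivSymbol_sq {k : Fin n → ℤ} (hk : k ≠ 0) :
    4 * Real.pi ^ 2 ≤ ∑ i, ‖derivSymbol i k‖ ^ 2 := by
  obtain ⟨i, hi⟩ := Function.ne_iff.1 hk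
  have h_one : (1 : ℝ) ≤ |(k i : ℝ)| := by exact_mod_cast Int.one_le_abs hi
  calc 4 * Real.pi ^ 2 = (2 * Real.pi * 1) ^ 2 := by ring
    _ ≤ ‖derivSymbol i k‖ ^ 2 := by rw [norm_derivSymbol]; gcongr
    _ ≤ ∑ i, ‖derivSymbol i k‖ ^ 2 := Finset.single_le_sum
        (f := fun i => ‖derivSymbol i k‖ ^ 2) (fun j _ => by positivity) (Finset.mem_univ i)

lemma poincare {u : L2per n} (hu : u ∈ H1per n) (h_mean : ∫ y in unitCell n, u y = 0) :
    4 * Real.pi ^ 2 * ‖u‖ ^ 2 ≤ ∑ i, ‖weakPartial i u‖ ^ 2 := by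
  refine hasSum_le (fun k => ?_) ((hasSum_norm_cellFourierCoeff_sq u).mul_left (4 * Real.pi ^ 2))
    (hasSum_sum fun i _ => hasSum_norm_cellFourierCoeff_sq (weakPartial i u))
  simp only [cellFourierCoeff_weakPartial hu, norm_mul, mul_pow, ← Finset.sum_mul]
  rcases eq_or_ne k 0 with rfl | hk
  · rw [(integral_eq_zero_iff_cellFourierCoeff u).1 h_mean]
    simp
  · exact mul_le_mul_of_nonneg_right (le_sum_norm_derivSymbol_sq hk) (by positivity)

/-! ### The Laplacian and gradient fields -/

/-- The Fourier symbol `-4π²|k|²` of the Laplacian. -/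
def laplSymbol (k : Fin n → ℤ) : ℂ := ∑ i, derivSymbol i k * derivSymbol i k

lemma norm_laplSymbol (k : Fin n → ℤ) : ‖laplSymbol k‖ = ∑ i, ‖derivSymbol i k‖ ^ 2 := by
  have h_real : laplSymbol k = -((∑ i, ‖derivSymbol i k‖ ^ 2 : ℝ) : ℂ) := by
    rw [laplSymbol, Complex.ofReal_sum, ← Finset.sum_neg_distrib]
    refine Finset.sum_congr rfl fun i _ => ?_
    rw [Complex.ofReal_pow, ← Complex.conj_mul', conj_derivSymbol, neg_mul, neg_neg]
  rw [h_real, norm_neg, Complex.norm_real, Real.norm_of_nonneg (by positivity)]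

lemma one_le_norm_laplSymbol {k : Fin n → ℤ} (hk : k ≠ 0) : 1 ≤ ‖laplSymbol k‖ := by
  rw [norm_laplSymbol]
  refine le_trans ?_ (le_sum_norm_derivSymbol_sq hk)
  nlinarith [Real.pi_gt_three]

lemma laplSymbol_ne_zero {k : Fin n → ℤ} (hk : k ≠ 0) : laplSymbol k ≠ 0 :=
  norm_pos_iff.1 (one_pos.trans_le (one_le_norm_laplSymbol hk))

lemma norm_derivSymbol_sq_le (i : Fin n) (k : Fin n → ℤ) :
    ‖derivSymbol i k‖ ^ 2 ≤ ‖laplSymbol k‖ := by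
  rw [norm_laplSymbol]
  exact Finset.single_le_sum (f := fun i => ‖derivSymbol i k‖ ^ 2)
    (fun j _ => by positivity) (Finset.mem_univ i)

lemma conj_laplSymbol (k : Fin n → ℤ) : conj (laplSymbol k) = laplSymbol k := by
  simp [laplSymbol, conj_derivSymbol]

lemma laplSymbol_neg (k : Fin n → ℤ) : laplSymbol (-k) = laplSymbol k := by
  simp [laplSymbol, derivSymbol_neg]

lemma cellFourierCoeff_lapl {u : L2per n} (hu : u ∈ H2per n) (k : Fin n → ℤ) :
    cellFourierCoeff (lapl u) k = laplSymbol k * cellFourierCoeff u k := by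
  simp only [lapl, laplSymbol, cellFourierCoeff_sum, cellFourierCoeff_weakPartial (hu.2 _),
    cellFourierCoeff_weakPartial hu.1, Finset.sum_mul, mul_assoc]

lemma exists_cellFourierCoeff_eq_div_laplSymbol {m : (Fin n → ℤ) → ℂ}
    (hm : ∀ k, m (-k) = conj (m k)) (h_le : ∀ k, k ≠ 0 → ‖m k‖ ≤ ‖laplSymbol k‖) (f : L2per n) :
    ∃ u : L2per n, ∀ k, cellFourierCoeff u k = m k / laplSymbol k * cellFourierCoeff f k := by
  refine exists_cellFourierCoeff_eq_mul (C := 1) (fun k => ?_) (fun k => ?_) f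
  · rcases eq_or_ne k 0 with rfl | hk
    · simp [laplSymbol, derivSymbol]
    · rw [norm_div]
      exact div_le_one_of_le₀ (h_le k hk) (norm_nonneg _)
  · rw [hm, laplSymbol_neg, map_div₀, conj_laplSymbol]

lemma exists_lapl_eq {f : L2per n} (hf : ∫ y in unitCell n, f y = 0) :
    ∃ φ ∈ H2per0 n, lapl φ = f := by
  have hf_zero := (integral_eq_zero_iff_cellFourierCoeff f).1 hf
  obtain ⟨φ, hφ⟩ := exists_cellFourierCoeff_eq_div_laplSymbol (m := fun _ => 1) (by simp)
    (fun k hk => by simpa using one_le_norm_laplSymbol hk) f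
  have h_first (i : Fin n) := exists_cellFourierCoeff_eq_div_laplSymbol (m := derivSymbol i)
    (by simp [derivSymbol_neg, conj_derivSymbol]) (fun k hk => by
      nlinarith [one_le_norm_laplSymbol hk, norm_derivSymbol_sq_le i k]) f
  have h_second (i j : Fin n) := exists_cellFourierCoeff_eq_div_laplSymbol
    (m := fun k => derivSymbol i k * derivSymbol j k)
    (by simp [derivSymbol_neg, conj_derivSymbol]) (fun k _ => by
      rw [norm_mul]
      nlinarith [norm_derivSymbol_sq_le i k, norm_derivSymbol_sq_le j k,
        sq_nonneg (‖derivSymbol i k‖ - ‖derivSymbol j k‖)]) f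
  choose g hg using h_first
  choose h hh using h_second
  have hφg (i : Fin n) : IsWeakPartial i φ (g i) :=
    isWeakPartial_iff.2 fun k => by rw [hg, hφ]; ring
  have hgh (i j : Fin n) : IsWeakPartial i (g j) (h i j) :=
    isWeakPartial_iff.2 fun k => by rw [hg, hh]; ring
  have h_mem : φ ∈ H2per n :=
    ⟨fun i => ⟨_, hφg i⟩, fun j => by rw [(hφg j).weakPartial_eq]; exact fun i => ⟨_, hgh i j⟩⟩
  refine ⟨φ, ⟨h_mem, ?_⟩, cellFourierCoeff_injective <| funext fun k => ?_⟩
  · rw [integral_eq_zero_iff_cellFourierCoeff, hφ, hf_zero, mul_zero]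
  · rw [cellFourierCoeff_lapl h_mem, hφ]
    rcases eq_or_ne k 0 with rfl | hk
    · rw [hf_zero, mul_zero, mul_zero]
    · rw [one_div, mul_inv_cancel_left₀ (laplSymbol_ne_zero hk)]

lemma grad_mem_H1per0Vec {u : L2per n} (hu : u ∈ H2per n) : grad u ∈ H1per0Vec n :=
  fun i => ⟨hu.2 i, integral_weakPartial hu.1 i⟩

lemma jac_grad_comm {u : L2per n} (hu : u ∈ H2per n) (i j : Fin n) :
    jac (grad u) i j = jac (grad u) j i := weakPartial_comm hu j i

lemma divg_grad (u : L2per n) : divg (grad u) = lapl u := rfl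

lemma secondOrderOp_eq_firstOrderOp_grad {A : (Fin n → ℝ) → Matrix (Fin n) (Fin n) ℝ}
    {b : (Fin n → ℝ) → Fin n → ℝ} {u : L2per n} (hu : u ∈ H2per n) :
    secondOrderOp A b u = firstOrderOp A b (grad u) := by
  funext x
  simp only [secondOrderOp, firstOrderOp]
  congr 1
  refine Finset.sum_congr rfl fun i _ => Finset.sum_congr rfl fun j _ => ?_
  rw [weakPartial_comm hu]
  rfl

lemma grad_injOn : Set.InjOn (grad (n := n)) (H2per0 n) := by
  intro u hu v hv huv
  have h_lapl : lapl u = lapl v := by rw [← divg_grad, ← divg_grad, huv]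
  refine cellFourierCoeff_injective <| funext fun k => ?_
  rcases eq_or_ne k 0 with rfl | hk
  · rw [(integral_eq_zero_iff_cellFourierCoeff u).1 hu.2,
      (integral_eq_zero_iff_cellFourierCoeff v).1 hv.2]
  · refine mul_left_cancel₀ (laplSymbol_ne_zero hk) ?_
    rw [← cellFourierCoeff_lapl hu.1, ← cellFourierCoeff_lapl hv.1, h_lapl]

lemma exists_grad_eq_of_jac_symm {w : Fin n → L2per n} (hw : w ∈ H1per0Vec n)
    (h_symm : ∀ i j, jac w i j = jac w j i) : ∃ φ ∈ H2per0 n, grad φ = w := by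
  obtain ⟨φ, hφ, h_lapl⟩ := exists_lapl_eq (integral_divg hw)
  refine ⟨φ, hφ, funext fun j => cellFourierCoeff_injective <| funext fun k => ?_⟩
  rw [grad, cellFourierCoeff_weakPartial hφ.1.1]
  rcases eq_or_ne k 0 with rfl | hk
  · rw [(integral_eq_zero_iff_cellFourierCoeff φ).1 hφ.2,
      (integral_eq_zero_iff_cellFourierCoeff _).1 (hw j).2, mul_zero]
  · have h_swap (i : Fin n) : derivSymbol j k * cellFourierCoeff (w i) k =
        derivSymbol i k * cellFourierCoeff (w j) k := by
      rw [← cellFourierCoeff_weakPartial (hw i).1, ← cellFourierCoeff_weakPartial (hw j).1]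
      exact congrArg (cellFourierCoeff · k) (h_symm i j)
    refine mul_left_cancel₀ (laplSymbol_ne_zero hk) ?_
    calc laplSymbol k * (derivSymbol j k * cellFourierCoeff φ k)
        = derivSymbol j k * cellFourierCoeff (divg w) k := by
          rw [← h_lapl, cellFourierCoeff_lapl hφ.1, mul_left_comm]
      _ = ∑ i, derivSymbol i k * (derivSymbol j k * cellFourierCoeff (w i) k) := by
          simp only [divg, cellFourierCoeff_sum, cellFourierCoeff_weakPartial (hw _).1,
            Finset.mul_sum, mul_left_comm]
      _ = laplSymbol k * cellFourierCoeff (w j) k := by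
          simp only [h_swap, laplSymbol, Finset.sum_mul, mul_assoc]

/-! ### Jets of vector fields -/

/-- The space `L²(Y)^{n(n+1)}`, in which a vector field is recorded together with its Jacobian:
the index `(i, none)` stands for `wᵢ` and `(i, some j)` for `∂ⱼwᵢ`. -/
abbrev JetSpace (n : ℕ) : Type := PiLp 2 fun _ : Fin n × Option (Fin n) => L2per n

/-- The coordinate projections of `JetSpace`. -/
def jetProj (p : Fin n × Option (Fin n)) : JetSpace n →L[ℝ] L2per n :=
  PiLp.proj (𝕜 := ℝ) 2 (fun _ : Fin n × Option (Fin n) => L2per n) p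

lemma jetProj_apply (p : Fin n × Option (Fin n)) (x : JetSpace n) : jetProj p x = x p := rfl

/-- The vector field `w` together with its Jacobian. -/
def jet (w : Fin n → L2per n) : JetSpace n :=
  WithLp.toLp 2 fun p => p.2.elim (w p.1) fun j => jac w p.1 j

lemma jet_none (w : Fin n → L2per n) (i : Fin n) : jet w (i, none) = w i := rfl

lemma jet_some (w : Fin n → L2per n) (i j : Fin n) : jet w (i, some j) = jac w i j := rfl

lemma jet_add {v w : Fin n → L2per n} (hv : v ∈ H1per0Vec n) (hw : w ∈ H1per0Vec n) :
    jet (v + w) = jet v + jet w := by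
  ext1 ⟨i, _ | j⟩
  · rfl
  · exact weakPartial_add (hv i).1 (hw i).1 j

lemma jet_smul (c : ℝ) {w : Fin n → L2per n} (hw : w ∈ H1per0Vec n) :
    jet (c • w) = c • jet w := by
  ext1 ⟨i, _ | j⟩
  · rfl
  · exact weakPartial_smul c (hw i).1 j

lemma sub_mem_H1per0Vec {v w : Fin n → L2per n} (hv : v ∈ H1per0Vec n) (hw : w ∈ H1per0Vec n) :
    v - w ∈ H1per0Vec n := (h1per0Vec n).sub_mem hv hw

lemma jet_sub {v w : Fin n → L2per n} (hv : v ∈ H1per0Vec n) (hw : w ∈ H1per0Vec n) :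
    jet (v - w) = jet v - jet w := by
  rw [eq_sub_iff_add_eq, ← jet_add (sub_mem_H1per0Vec hv hw) hw, sub_add_cancel]

lemma jac_sub {v w : Fin n → L2per n} (hv : v ∈ H1per0Vec n) (hw : w ∈ H1per0Vec n)
    (i j : Fin n) : jac (v - w) i j = jac v i j - jac w i j := by
  rw [← jet_some, jet_sub hv hw]
  rfl

lemma isClosedSubspace_h1per0Vec : IsClosedSubspace (h1per0Vec n) :=
  ⟨fun _ h => h, fun _ _ _ hv _ => hv⟩

lemma norm_jet (w : Fin n → L2per n) : ‖jet w‖ = h1Norm w := by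
  rw [PiLp.norm_eq_of_L2, h1Norm, Fintype.sum_prod_type]
  simp only [Fintype.sum_option, jet_none, jet_some, Finset.sum_add_distrib]

lemma jacNorm_nonneg (w : Fin n → L2per n) : 0 ≤ jacNorm w := Real.sqrt_nonneg _

lemma jacNorm_sq (w : Fin n → L2per n) : jacNorm w ^ 2 = ∑ i, ∑ j, ‖jac w i j‖ ^ 2 :=
  Real.sq_sqrt (by positivity)

lemma h1Norm_sq (w : Fin n → L2per n) : h1Norm w ^ 2 = ∑ i, ‖w i‖ ^ 2 + jacNorm w ^ 2 := by
  rw [h1Norm, Real.sq_sqrt (by positivity), jacNorm_sq]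

lemma h1Norm_sq_le {w : Fin n → L2per n} (hw : w ∈ H1per0Vec n) :
    h1Norm w ^ 2 ≤ (1 + 1 / (4 * Real.pi ^ 2)) * jacNorm w ^ 2 := by
  have h_poincare : 4 * Real.pi ^ 2 * ∑ i, ‖w i‖ ^ 2 ≤ jacNorm w ^ 2 := by
    rw [jacNorm_sq, Finset.mul_sum]
    exact Finset.sum_le_sum fun i _ => poincare (hw i).1 (hw i).2
  rw [h1Norm_sq, add_mul, one_mul, add_comm, one_div, inv_mul_eq_div]
  gcongr
  rwa [le_div_iff₀' (by positivity)]

lemma h1Norm_le {w : Fin n → L2per n} (hw : w ∈ H1per0Vec n) :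
    h1Norm w ≤ √(1 + 1 / (4 * Real.pi ^ 2)) * jacNorm w := by
  refine le_of_sq_le_sq ?_ (mul_nonneg (Real.sqrt_nonneg _) (jacNorm_nonneg _))
  rw [mul_pow, Real.sq_sqrt (by positivity)]
  exact h1Norm_sq_le hw

lemma eq_zero_of_jacNorm_eq_zero {w : Fin n → L2per n} (hw : w ∈ H1per0Vec n)
    (h : jacNorm w = 0) : w = 0 := by
  have h_jet : jet w = 0 := by
    rw [← norm_le_zero_iff, norm_jet]
    simpa [h] using h1Norm_le hw
  funext i
  rw [← jet_none w, h_jet]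
  rfl

lemma norm_divg_le {w : Fin n → L2per n} (hw : w ∈ H1per0Vec n) : ‖divg w‖ ≤ jacNorm w := by
  refine le_of_sq_le_sq ?_ (jacNorm_nonneg w)
  have h := inner_divg_add_inner_skew hw hw
  simp only [real_inner_self_eq_norm_sq] at h
  rw [jacNorm_sq, ← h]
  exact le_add_of_nonneg_right (by positivity)

lemma sum_inner_jac_le (v w : Fin n → L2per n) :
    ∑ i, ∑ j, inner ℝ (jac v i j) (jac w i j) ≤ jacNorm v * jacNorm w := by
  calc ∑ i, ∑ j, inner ℝ (jac v i j) (jac w i j)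
      ≤ ∑ p : Fin n × Fin n, ‖jac v p.1 p.2‖ * ‖jac w p.1 p.2‖ := by
        rw [Fintype.sum_prod_type]
        exact Finset.sum_le_sum fun i _ => Finset.sum_le_sum fun j _ => real_inner_le_norm _ _
    _ ≤ jacNorm v * jacNorm w := by
        simpa only [Fintype.sum_prod_type, jacNorm] using Real.sum_mul_le_sqrt_mul_sqrt Finset.univ
          (fun p : Fin n × Fin n => ‖jac v p.1 p.2‖) fun p => ‖jac w p.1 p.2‖

/-- The jets of the fields in a subspace of `H¹_{per,0}(Y;ℝⁿ)`. -/
def jetSubmodule (P : Submodule ℝ (Fin n → L2per n))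
    (hP : (P : Set (Fin n → L2per n)) ⊆ H1per0Vec n) : Submodule ℝ (JetSpace n) where
  carrier := jet '' P
  zero_mem' := ⟨0, P.zero_mem, by simpa using jet_smul (0 : ℝ) (hP P.zero_mem)⟩
  add_mem' := by
    rintro _ _ ⟨v, hv, rfl⟩ ⟨w, hw, rfl⟩
    exact ⟨v + w, P.add_mem hv hw, jet_add (hP hv) (hP hw)⟩
  smul_mem' := by
    rintro c _ ⟨w, hw, rfl⟩
    exact ⟨c • w, P.smul_mem c hw, jet_smul c (hP hw)⟩

lemma continuous_cellFourierCoeff (k : Fin n → ℤ) :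
    Continuous fun u : L2per n => cellFourierCoeff u k := by
  simp only [cellFourierCoeff, HilbertBasis.repr_apply_apply]
  fun_prop

lemma isClosed_setOf_isWeakPartial (i : Fin n) :
    IsClosed {p : L2per n × L2per n | IsWeakPartial i p.1 p.2} := by
  simp only [isWeakPartial_iff, Set.ofPred_forall]
  exact isClosed_iInter fun k => isClosed_eq
    ((continuous_cellFourierCoeff k).comp continuous_snd)
    (((continuous_cellFourierCoeff k).comp continuous_fst).const_mul _)

lemma isClosed_jetSubmodule_h1per0Vec :
    IsClosed (jetSubmodule (h1per0Vec n) subset_rfl : Set (JetSpace n)) := by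
  have h_eq : (jetSubmodule (h1per0Vec n) subset_rfl : Set (JetSpace n)) =
      {x | ∀ i, (∀ j, IsWeakPartial j (jetProj (i, none) x) (jetProj (i, some j) x)) ∧
        cellFourierCoeff (jetProj (i, none) x) 0 = 0} := by
    ext x
    constructor
    · rintro ⟨w, hw, rfl⟩ i
      exact ⟨fun j => isWeakPartial_weakPartial (hw i).1 j,
        (integral_eq_zero_iff_cellFourierCoeff _).1 (hw i).2⟩
    · intro hx
      refine ⟨fun i => x (i, none), fun i => ⟨fun j => ⟨_, (hx i).1 j⟩,
        (integral_eq_zero_iff_cellFourierCoeff _).2 (hx i).2⟩, ?_⟩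
      ext1 ⟨i, _ | j⟩
      · rfl
      · exact ((hx i).1 j).weakPartial_eq
  rw [h_eq]
  simp only [Set.ofPred_forall, Set.ofPred_and]
  exact isClosed_iInter fun i => (isClosed_iInter fun j =>
    (isClosed_setOf_isWeakPartial j).preimage (by fun_prop :
      Continuous fun x : JetSpace n => (jetProj (i, none) x, jetProj (i, some j) x))).inter
    (isClosed_eq ((continuous_cellFourierCoeff 0).comp (jetProj _).continuous) continuous_const)

lemma isClosed_jetSubmodule {P : Submodule ℝ (Fin n → L2per n)} (hP : IsClosedSubspace P) :
    IsClosed (jetSubmodule P hP.1 : Set (JetSpace n)) := by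
  refine IsSeqClosed.isClosed fun x y hx hy => ?_
  choose w hwP hwx using hx
  obtain ⟨v, hv, rfl⟩ : y ∈ jetSubmodule (h1per0Vec n) subset_rfl :=
    isClosed_jetSubmodule_h1per0Vec.mem_of_tendsto hy
      (Eventually.of_forall fun k => ⟨w k, hP.1 (hwP k), hwx k⟩)
  refine ⟨v, hP.2 w v hwP hv ((tendsto_iff_norm_sub_tendsto_zero.1 hy).congr fun k => ?_), rfl⟩
  rw [← norm_jet, jet_sub (hP.1 (hwP k)) hv, hwx]

/-! ### Pairing with bounded coefficients -/

section Pairing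

variable {α : Type*} {mα : MeasurableSpace α} {μ : Measure α}

lemma norm_sq_eq_integral (u : Lp ℝ 2 μ) : ‖u‖ ^ 2 = ∫ y, u y ^ 2 ∂μ := by
  rw [← real_inner_self_eq_norm_sq, ← integral_mul_eq_inner]
  simp only [pow_two]

lemma exists_pairing {ι : Type*} [Fintype ι] {c : ι → α → ℝ} (hc : ∀ p, MemLp (c p) ⊤ μ) :
    ∃ R : PiLp 2 (fun _ : ι => Lp ℝ 2 μ) →L[ℝ] Lp ℝ 2 μ,
      ∀ x, R x =ᵐ[μ] fun y => ∑ p, c p y * x p y := by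
  let mulBy (p : ι) : Lp ℝ 2 μ →L[ℝ] Lp ℝ 2 μ :=
    (ContinuousLinearMap.mul ℝ ℝ).holderL μ ⊤ 2 2 ((hc p).toLp (c p))
  have h_mulBy (p : ι) (u : Lp ℝ 2 μ) : mulBy p u =ᵐ[μ] fun y => c p y * u y := by
    filter_upwards [(ContinuousLinearMap.mul ℝ ℝ).coeFn_holder (r := 2) ((hc p).toLp (c p)) u,
      (hc p).coeFn_toLp] with y h_holder h_toLp
    rw [ContinuousLinearMap.holderL_apply_apply, h_holder, h_toLp, ContinuousLinearMap.mul_apply']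
  refine ⟨∑ p, mulBy p ∘L PiLp.proj (𝕜 := ℝ) 2 (fun _ : ι => Lp ℝ 2 μ) p, fun x => ?_⟩
  have h_apply : (∑ p, mulBy p ∘L PiLp.proj (𝕜 := ℝ) 2 (fun _ : ι => Lp ℝ 2 μ) p) x =
      ∑ p, mulBy p (x p) := by
    simp
  rw [h_apply]
  filter_upwards [Lp.coeFn_finsetSum Finset.univ fun p => mulBy p (x p),
    ae_all_iff.2 fun p => h_mulBy p (x p)] with y h_sum h_mul
  rw [h_sum, Finset.sum_apply]
  exact Finset.sum_congr rfl fun p _ => h_mul p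

lemma norm_sq_le_of_ae_eq_sum_mul {ι : Type*} [Fintype ι] {c : ι → α → ℝ} {K : ℝ}
    (hK : ∀ᵐ y ∂μ, ∑ p, c p y ^ 2 ≤ K) {x : PiLp 2 fun _ : ι => Lp ℝ 2 μ} {u : Lp ℝ 2 μ}
    (hu : u =ᵐ[μ] fun y => ∑ p, c p y * x p y) : ‖u‖ ^ 2 ≤ K * ‖x‖ ^ 2 := by
  have h_int (p : ι) : Integrable (fun y => x p y ^ 2) μ := (Lp.memLp (x p)).integrable_sq
  have h_norm : K * ‖x‖ ^ 2 = ∫ y, K * ∑ p, x p y ^ 2 ∂μ := by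
    rw [integral_const_mul, integral_finsetSum _ fun p _ => h_int p, PiLp.norm_sq_eq_of_L2]
    simp only [norm_sq_eq_integral]
  rw [norm_sq_eq_integral, h_norm]
  refine integral_mono_ae (Lp.memLp u).integrable_sq
    ((integrable_finsetSum _ fun p _ => h_int p).const_mul _) ?_
  filter_upwards [hu, hK] with y hy hKy
  rw [hy]
  exact (Finset.sum_mul_sq_le_sq_mul_sq _ _ _).trans
    (mul_le_mul_of_nonneg_right hKy (Finset.sum_nonneg fun _ _ => sq_nonneg _))

end Pairing

/-! ### Perturbations of the divergence -/

lemma exists_solution_of_coercive {E : Type*} [NormedAddCommGroup E] [InnerProductSpace ℝ E]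
    [CompleteSpace E] (B : E →L[ℝ] E →L[ℝ] ℝ) (l : E →L[ℝ] ℝ) {K : Submodule ℝ E}
    (hK : IsClosed (K : Set E)) {c : ℝ} (hc : 0 < c) (hB : ∀ x ∈ K, c * ‖x‖ ^ 2 ≤ B x x) :
    ∃ u ∈ K, ∀ v ∈ K, B v u = l v := by
  have : CompleteSpace K := hK.completeSpace_coe
  have h_coercive : IsCoercive (B.flip.bilinearComp K.subtypeL K.subtypeL) :=
    ⟨c, hc, fun x => by simpa [pow_two, mul_assoc] using hB x x.2⟩
  let f := (InnerProductSpace.toDual ℝ K).symm (l ∘L K.subtypeL)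
  let u := h_coercive.continuousLinearEquivOfBilin.symm f
  refine ⟨u, u.2, fun v hv => ?_⟩
  have h_u := h_coercive.continuousLinearEquivOfBilin_apply u ⟨v, hv⟩
  rw [ContinuousLinearEquiv.apply_symm_apply, InnerProductSpace.toDual_symm_apply] at h_u
  simpa using h_u.symm

lemma eq_zero_of_inner_eq_zero {α : Type*} {mα : MeasurableSpace α} {μ : Measure α}
    [IsFiniteMeasure μ] {s g : Lp ℝ 2 μ} (h_mean : ∫ x, s x ∂μ ≠ 0) (h_inner : inner ℝ s g = 0)
    (h : ∀ u : Lp ℝ 2 μ, ∫ x, u x ∂μ = 0 → inner ℝ u g = 0) : g = 0 := by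
  have h_int (u : Lp ℝ 2 μ) : Integrable u μ := (Lp.memLp u).integrable one_le_two
  let c := (∫ x, g x ∂μ) / ∫ x, s x ∂μ
  have h_zero : ∫ x, (g - c • s) x ∂μ = 0 := by
    have h_ae : (g - c • s : Lp ℝ 2 μ) =ᵐ[μ] fun x => g x - c * s x := by
      filter_upwards [Lp.coeFn_sub g (c • s), Lp.coeFn_smul c s] with x h_sub h_smul
      rw [h_sub, Pi.sub_apply, h_smul, Pi.smul_apply, smul_eq_mul]
    rw [integral_congr_ae h_ae, integral_sub (h_int g) ((h_int s).const_mul c),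
      integral_const_mul, div_mul_cancel₀ _ h_mean, sub_self]
  have h_orth := h _ h_zero
  rwa [inner_sub_left, real_inner_smul_left, h_inner, mul_zero, sub_zero, inner_self_eq_zero]
    at h_orth

/-- The divergence of a jet. -/
def jetDiv (n : ℕ) : JetSpace n →L[ℝ] L2per n := ∑ i, jetProj (i, some i)

lemma jetDiv_jet (w : Fin n → L2per n) : jetDiv n (jet w) = divg w := by
  simp [jetDiv, jetProj_apply, jet_some, jac, divg]

/-- The bilinear form `(x, y) ↦ ⟪S x, T y⟫` on jets. -/
def innerPullback (S T : JetSpace n →L[ℝ] L2per n) : JetSpace n →L[ℝ] JetSpace n →L[ℝ] ℝ :=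
  (isBoundedBilinearMap_inner (𝕜 := ℝ) (E := L2per n)).toContinuousLinearMap.bilinearComp S T

lemma innerPullback_apply (S T : JetSpace n →L[ℝ] L2per n) (x y : JetSpace n) :
    innerPullback S T x y = inner ℝ (S x) (T y) := rfl

/-- The form `(v, w) ↦ ∫ (∇·v) L(w, Dw) + ½ ∫ (Dv - (Dv)ᵀ) : (Dw - (Dw)ᵀ)` on jets. It is `B₂` when
`L` is the renormalized operator `Ã : Dw + b̃ · w`. -/
def jetForm (L : JetSpace n →L[ℝ] L2per n) : JetSpace n →L[ℝ] JetSpace n →L[ℝ] ℝ :=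
  innerPullback (jetDiv n) L + (1 / 2 : ℝ) • ∑ i, ∑ j,
    innerPullback (jetProj (i, some j) - jetProj (j, some i))
      (jetProj (i, some j) - jetProj (j, some i))

lemma jetForm_jet (L : JetSpace n →L[ℝ] L2per n) (v w : Fin n → L2per n) :
    jetForm L (jet v) (jet w) = inner ℝ (divg v) (L (jet w)) + (1 / 2) * ∑ i, ∑ j,
      inner ℝ (jac v i j - jac v j i) (jac w i j - jac w j i) := by
  simp only [jetForm, add_apply, smul_apply, sum_apply, innerPullback_apply, jetDiv_jet, sub_apply,
    jetProj_apply, jet_some, smul_eq_mul]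

lemma jetForm_jet_eq (L : JetSpace n →L[ℝ] L2per n) {v w : Fin n → L2per n}
    (hv : v ∈ H1per0Vec n) (hw : w ∈ H1per0Vec n) :
    jetForm L (jet v) (jet w) = ∑ i, ∑ j, inner ℝ (jac v i j) (jac w i j) +
      inner ℝ (divg v) (L (jet w) - divg w) := by
  rw [jetForm_jet, ← inner_divg_add_inner_skew hv hw, inner_sub_right]
  ring

lemma jetForm_jet_grad (L : JetSpace n →L[ℝ] L2per n) (v : Fin n → L2per n) {u : L2per n}
    (hu : u ∈ H2per n) :
    jetForm L (jet v) (jet (grad u)) = inner ℝ (divg v) (L (jet (grad u))) := by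
  simp [jetForm_jet, fun i j => sub_eq_zero.2 (jac_grad_comm hu i j)]

-- Writing `∇·ξ = Δφ`, the test field `ξ - ∇φ` is divergence free, so that the equation reduces to
-- the vanishing of the skew part of its Jacobian.
lemma jac_comm_of_jetForm_eq {L : JetSpace n →L[ℝ] L2per n} {ξ : Fin n → L2per n}
    (hξ : ξ ∈ H1per0Vec n) {f : L2per n}
    (h : ∀ w ∈ H1per0Vec n, jetForm L (jet w) (jet ξ) = inner ℝ (divg w) f) (i j : Fin n) :
    jac ξ i j = jac ξ j i := by
  obtain ⟨φ, hφ, h_lapl⟩ := exists_lapl_eq (integral_divg hξ)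
  have h_grad := grad_mem_H1per0Vec hφ.1
  have h_mem := sub_mem_H1per0Vec hξ h_grad
  have h_div : divg (ξ - grad φ) = 0 := by
    rw [← jetDiv_jet, jet_sub hξ h_grad, map_sub, jetDiv_jet, jetDiv_jet, divg_grad, h_lapl,
      sub_self]
  have h_skew (i j : Fin n) : jac (ξ - grad φ) i j - jac (ξ - grad φ) j i =
      jac ξ i j - jac ξ j i := by
    rw [jac_sub hξ h_grad, jac_sub hξ h_grad, jac_grad_comm hφ.1 i j, sub_sub_sub_cancel_right]
  have h_sum := h _ h_mem
  simp only [jetForm_jet, h_div, inner_zero_left, zero_add, h_skew, real_inner_self_eq_norm_sq]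
    at h_sum
  have h_zero : ∑ p : Fin n × Fin n, ‖jac ξ p.1 p.2 - jac ξ p.2 p.1‖ ^ 2 = 0 := by
    rw [Fintype.sum_prod_type]
    linarith
  have h_entry := (Finset.sum_eq_zero_iff_of_nonneg fun p _ => sq_nonneg _).1 h_zero (i, j)
    (Finset.mem_univ _)
  exact sub_eq_zero.1 (norm_eq_zero.1 (pow_eq_zero_iff two_ne_zero |>.1 h_entry))

/-- Campanato's nearness condition: on `H¹_{per,0}(Y;ℝⁿ)` the first-order operator `L` differs from
the divergence by at most `q` times the norm of the Jacobian. -/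
def NearDivergence (q : ℝ) (L : JetSpace n →L[ℝ] L2per n) : Prop :=
  ∀ w ∈ H1per0Vec n, ‖L (jet w) - divg w‖ ≤ q * jacNorm w

/-- The part of an invariant measure that matters for the operator `L`: a nonzero `s ∈ L²(Y)`
orthogonal to `L(∇φ, D²φ)` for all `φ ∈ H²_{per,0}(Y)`. For the renormalized operator it is
`s = r / γ`. -/
structure IsAnnihilator (L : JetSpace n →L[ℝ] L2per n) (s : L2per n) : Prop where
  ne_zero : s ≠ 0
  inner_eq_zero : ∀ φ ∈ H2per0 n, inner ℝ s (L (jet (grad φ))) = 0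

namespace NearDivergence

variable {q : ℝ} {L : JetSpace n →L[ℝ] L2per n} {P : Submodule ℝ (Fin n → L2per n)}
  {v w ξ η : Fin n → L2per n}

lemma abs_inner_divg_le (hL : NearDivergence q L) (hv : v ∈ H1per0Vec n)
    (hw : w ∈ H1per0Vec n) :
    |inner ℝ (divg v) (L (jet w) - divg w)| ≤ q * (jacNorm v * jacNorm w) :=
  calc |inner ℝ (divg v) (L (jet w) - divg w)| ≤ ‖divg v‖ * ‖L (jet w) - divg w‖ :=
        abs_real_inner_le_norm _ _
    _ ≤ jacNorm v * (q * jacNorm w) :=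
        mul_le_mul (norm_divg_le hv) (hL w hw) (norm_nonneg _) (jacNorm_nonneg _)
    _ = q * (jacNorm v * jacNorm w) := by ring

lemma jetForm_coercive (hL : NearDivergence q L) (hw : w ∈ H1per0Vec n) :
    (1 - q) * jacNorm w ^ 2 ≤ jetForm L (jet w) (jet w) := by
  rw [jetForm_jet_eq L hw hw]
  simp only [real_inner_self_eq_norm_sq, ← jacNorm_sq]
  linarith [(abs_le.1 (hL.abs_inner_divg_le hw hw)).1]

lemma jetForm_le (hL : NearDivergence q L) (hv : v ∈ H1per0Vec n) (hw : w ∈ H1per0Vec n) :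
    jetForm L (jet v) (jet w) ≤ (1 + q) * (jacNorm v * jacNorm w) := by
  rw [jetForm_jet_eq L hv hw, add_mul, one_mul]
  exact add_le_add (sum_inner_jac_le v w) (le_of_abs_le (hL.abs_inner_divg_le hv hw))

lemma eq_of_jetForm_eq (hL : NearDivergence q L) (hq : q < 1)
    (hP : (P : Set (Fin n → L2per n)) ⊆ H1per0Vec n) (hξ : ξ ∈ P) (hη : η ∈ P)
    (h : ∀ w ∈ P, jetForm L (jet w) (jet ξ) = jetForm L (jet w) (jet η)) : ξ = η := by
  have h_diff := P.sub_mem hξ hη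
  have h_zero : jetForm L (jet (ξ - η)) (jet (ξ - η)) = 0 := by
    nth_rewrite 2 [jet_sub (hP hξ) (hP hη)]
    rw [map_sub, h _ h_diff, sub_self]
  have h_coercive := h_zero ▸ hL.jetForm_coercive (hP h_diff)
  have h_sq : jacNorm (ξ - η) ^ 2 = 0 :=
    le_antisymm (nonpos_of_mul_nonpos_right h_coercive (sub_pos.2 hq)) (sq_nonneg _)
  exact sub_eq_zero.1
    (eq_zero_of_jacNorm_eq_zero (hP h_diff) (pow_eq_zero_iff two_ne_zero |>.1 h_sq))

lemma exists_jetForm_eq (hL : NearDivergence q L) (hq : q < 1) (hP : IsClosedSubspace P)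
    (f : L2per n) : ∃ ξ ∈ P, ∀ w ∈ P, jetForm L (jet w) (jet ξ) = inner ℝ (divg w) f := by
  have h_pos : 0 < 1 + 1 / (4 * Real.pi ^ 2) := by positivity
  obtain ⟨_, ⟨ξ, hξ, rfl⟩, h⟩ := exists_solution_of_coercive (jetForm L)
    (innerSL ℝ f ∘L jetDiv n) (isClosed_jetSubmodule hP)
    (c := (1 - q) / (1 + 1 / (4 * Real.pi ^ 2))) (div_pos (sub_pos.2 hq) h_pos) (by
      rintro _ ⟨w, hw, rfl⟩
      refine le_trans ?_ (hL.jetForm_coercive (hP.1 hw))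
      rw [div_mul_eq_mul_div, mul_div_assoc]
      refine mul_le_mul_of_nonneg_left ?_ (sub_pos.2 hq).le
      rw [div_le_iff₀' h_pos, norm_jet]
      exact h1Norm_sq_le (hP.1 hw))
  refine ⟨ξ, hξ, fun w hw => ?_⟩
  rw [h _ ⟨w, hw, rfl⟩, ContinuousLinearMap.comp_apply, jetDiv_jet, innerSL_apply_apply,
    real_inner_comm]

lemma jacNorm_sub_le (hL : NearDivergence q L) (hq₀ : 0 ≤ q) (hq : q < 1)
    (hP : (P : Set (Fin n → L2per n)) ⊆ H1per0Vec n) (hξ : ξ ∈ H1per0Vec n) (hη : η ∈ P)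
    (h : ∀ w ∈ P, jetForm L (jet w) (jet ξ) = jetForm L (jet w) (jet η)) (hw : w ∈ P) :
    jacNorm (ξ - η) ≤ (1 + q) / (1 - q) * jacNorm (ξ - w) := by
  have h_mem := P.sub_mem hw hη
  have h_galerkin : jetForm L (jet (w - η)) (jet (ξ - η)) = 0 := by
    rw [jet_sub hξ (hP hη), map_sub, h _ h_mem, sub_self]
  have hξη := sub_mem_H1per0Vec hξ (hP hη)
  have hξw := sub_mem_H1per0Vec hξ (hP hw)
  have h_split : jet (ξ - η) = jet (ξ - w) + jet (w - η) := by
    rw [← jet_add hξw (hP h_mem), sub_add_sub_cancel]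
  have h_le : (1 - q) * jacNorm (ξ - η) ^ 2 ≤
      (1 + q) * jacNorm (ξ - w) * jacNorm (ξ - η) :=
    calc (1 - q) * jacNorm (ξ - η) ^ 2 ≤ jetForm L (jet (ξ - η)) (jet (ξ - η)) :=
          hL.jetForm_coercive hξη
      _ = jetForm L (jet (ξ - w)) (jet (ξ - η)) := by
          nth_rewrite 1 [h_split]
          rw [map_add, add_apply, h_galerkin, add_zero]
      _ ≤ (1 + q) * jacNorm (ξ - w) * jacNorm (ξ - η) := by
          rw [mul_assoc]
          exact hL.jetForm_le hξw hξη
  rw [div_mul_eq_mul_div, le_div_iff₀' (sub_pos.2 hq)]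
  rcases (jacNorm_nonneg (ξ - η)).eq_or_lt with h_zero | h_pos
  · rw [← h_zero, mul_zero]
    exact mul_nonneg (by linarith) (jacNorm_nonneg _)
  · rw [pow_two, ← mul_assoc] at h_le
    exact le_of_mul_le_mul_right h_le h_pos

lemma h1Norm_sub_le (hL : NearDivergence q L) (hq₀ : 0 ≤ q) (hq : q < 1)
    (hP : (P : Set (Fin n → L2per n)) ⊆ H1per0Vec n) (hξ : ξ ∈ H1per0Vec n) (hη : η ∈ P)
    (h : ∀ w ∈ P, jetForm L (jet w) (jet ξ) = jetForm L (jet w) (jet η)) :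
    h1Norm (ξ - η) ≤ √(1 + 1 / (4 * Real.pi ^ 2)) * ((1 + q) / (1 - q)) *
      ⨅ w : P, jacNorm (ξ - (w : Fin n → L2per n)) := by
  refine (h1Norm_le (sub_mem_H1per0Vec hξ (hP hη))).trans ?_
  rw [mul_assoc, Real.mul_iInf_of_nonneg (div_nonneg (by linarith) (by linarith))]
  gcongr
  exact le_ciInf fun w => hL.jacNorm_sub_le hq₀ hq hP hξ hη h w.2

lemma exists_grad_jetForm_eq (hL : NearDivergence q L) (hq : q < 1) (f : L2per n) :
    ∃ χ ∈ H2per0 n, ∀ w ∈ H1per0Vec n,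
      jetForm L (jet w) (jet (grad χ)) = inner ℝ (divg w) f := by
  obtain ⟨ξ, hξ, h⟩ := hL.exists_jetForm_eq hq isClosedSubspace_h1per0Vec f
  obtain ⟨χ, hχ, rfl⟩ := exists_grad_eq_of_jac_symm hξ (jac_comm_of_jetForm_eq hξ h)
  exact ⟨χ, hχ, h⟩

lemma integral_annihilator_ne_zero (hL : NearDivergence q L) (hq : q < 1) {s : L2per n}
    (hs : IsAnnihilator L s) : ∫ y in unitCell n, s y ≠ 0 := by
  intro h_mean
  obtain ⟨ψ, hψ, rfl⟩ := exists_lapl_eq h_mean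
  have h_grad := grad_mem_H1per0Vec hψ.1
  have h_coercive := hL.jetForm_coercive h_grad
  rw [jetForm_jet_grad L _ hψ.1, divg_grad, hs.inner_eq_zero ψ hψ] at h_coercive
  have h_jac : jacNorm (grad ψ) = 0 := pow_eq_zero_iff two_ne_zero |>.1 <|
    le_antisymm (nonpos_of_mul_nonpos_right h_coercive (sub_pos.2 hq)) (sq_nonneg _)
  exact hs.ne_zero (norm_le_zero_iff.1 ((norm_divg_le h_grad).trans_eq h_jac))

-- The Laplacians fill the functions of mean zero; together with `s`, which has nonzero mean, they
-- span `L²(Y)`.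
lemma eq_of_inner_lapl_eq (hL : NearDivergence q L) (hq : q < 1) {s f : L2per n}
    (hs : IsAnnihilator L s) (hf : inner ℝ s f = 0) {χ : L2per n} (hχ : χ ∈ H2per0 n)
    (h : ∀ φ ∈ H2per0 n, inner ℝ (lapl φ) (L (jet (grad χ))) = inner ℝ (lapl φ) f) :
    L (jet (grad χ)) = f := by
  refine sub_eq_zero.1 (eq_zero_of_inner_eq_zero (hL.integral_annihilator_ne_zero hq hs) ?_ ?_)
  · rw [inner_sub_right, hs.inner_eq_zero χ hχ, hf, sub_zero]
  · intro u hu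
    obtain ⟨φ, hφ, rfl⟩ := exists_lapl_eq hu
    rw [inner_sub_right, h φ hφ, sub_self]

lemma exists_apply_jet_grad_eq (hL : NearDivergence q L) (hq : q < 1) {s f : L2per n}
    (hs : IsAnnihilator L s) (hf : inner ℝ s f = 0) :
    ∃ χ ∈ H2per0 n, L (jet (grad χ)) = f := by
  obtain ⟨χ, hχ, h⟩ := hL.exists_grad_jetForm_eq hq f
  refine ⟨χ, hχ, hL.eq_of_inner_lapl_eq hq hs hf hχ fun φ hφ => ?_⟩
  rw [← divg_grad, ← jetForm_jet_grad L _ hχ.1, h _ (grad_mem_H1per0Vec hφ.1)]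

lemma eq_of_apply_jet_grad_eq (hL : NearDivergence q L) (hq : q < 1) {u v : L2per n}
    (hu : u ∈ H2per0 n) (hv : v ∈ H2per0 n) (h : L (jet (grad u)) = L (jet (grad v))) :
    u = v := by
  refine grad_injOn hu hv (hL.eq_of_jetForm_eq hq (P := h1per0Vec n) subset_rfl
    (grad_mem_H1per0Vec hu.1) (grad_mem_H1per0Vec hv.1) fun w _ => ?_)
  rw [jetForm_jet_grad L w hu.1, jetForm_jet_grad L w hv.1, h]

end NearDivergence

/-! ### The Cordes condition -/

/-- The deviation of `(Ã, b̃)` from `(Iₙ, 0)`, indexed like the coordinates of a jet. -/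
def cordesDev (A : (Fin n → ℝ) → Matrix (Fin n) (Fin n) ℝ) (b : (Fin n → ℝ) → Fin n → ℝ)
    (p : Fin n × Option (Fin n)) (x : Fin n → ℝ) : ℝ :=
  p.2.elim (renormb A b x p.1) fun j => renormA A b x p.1 j - if p.1 = j then 1 else 0

section Pointwise

variable {A : (Fin n → ℝ) → Matrix (Fin n) (Fin n) ℝ} {b : (Fin n → ℝ) → Fin n → ℝ}
  {x : Fin n → ℝ} {δ : ℝ}

lemma diag_sq_le_coeffSq (A : (Fin n → ℝ) → Matrix (Fin n) (Fin n) ℝ)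
    (b : (Fin n → ℝ) → Fin n → ℝ) (x : Fin n → ℝ) (i : Fin n) : A x i i ^ 2 ≤ coeffSq A b x :=
  calc A x i i ^ 2 ≤ ∑ j, A x i j ^ 2 :=
        Finset.single_le_sum (f := fun j => A x i j ^ 2) (fun _ _ => sq_nonneg _)
          (Finset.mem_univ i)
    _ ≤ ∑ i, ∑ j, A x i j ^ 2 :=
        Finset.single_le_sum (f := fun i => ∑ j, A x i j ^ 2)
          (fun _ _ => Finset.sum_nonneg fun _ _ => sq_nonneg _) (Finset.mem_univ i)
    _ ≤ coeffSq A b x := le_add_of_nonneg_right (Finset.sum_nonneg fun _ _ => sq_nonneg _)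

lemma coeffSq_pos (h_trace : (A x).trace ≠ 0) : 0 < coeffSq A b x := by
  obtain ⟨i, -, hi⟩ := Finset.exists_ne_zero_of_sum_ne_zero h_trace
  exact (pow_pos (abs_pos.2 hi) 2).trans_le ((sq_abs _).trans_le (diag_sq_le_coeffSq A b x i))

lemma renorm_ne_zero (h_trace : (A x).trace ≠ 0) : renorm A b x ≠ 0 :=
  div_ne_zero h_trace (coeffSq_pos h_trace).ne'

lemma sum_cordesDev_sq (h_trace : (A x).trace ≠ 0) :
    ∑ p, cordesDev A b p x ^ 2 = n - (A x).trace ^ 2 / coeffSq A b x := by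
  have h_entry (i j : Fin n) : (renormA A b x i j - if i = j then 1 else 0) ^ 2 =
      renorm A b x ^ 2 * A x i j ^ 2 -
        (if i = j then 2 * renorm A b x * A x i j else 0) + if i = j then 1 else 0 := by
    simp only [renormA, Matrix.smul_apply, smul_eq_mul]
    split_ifs <;> ring
  have h_expand : ∑ p, cordesDev A b p x ^ 2 =
      renorm A b x ^ 2 * coeffSq A b x - 2 * renorm A b x * (A x).trace + n := by
    simp only [Fintype.sum_prod_type, Fintype.sum_option, cordesDev, Option.elim, h_entry,
      Finset.sum_add_distrib, Finset.sum_sub_distrib, Finset.sum_ite_eq, Finset.mem_univ, if_true,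
      renormb, Pi.smul_apply, smul_eq_mul, mul_pow, coeffSq, Matrix.trace, Matrix.diag_apply,
      Finset.mul_sum, Finset.sum_const, Finset.card_univ, Fintype.card_fin, nsmul_eq_mul, mul_one,
      mul_add]
    ring
  have h_pos := coeffSq_pos (b := b) h_trace
  rw [h_expand, renorm]
  field_simp
  ring

lemma sum_cordesDev_sq_le (h_trace : (A x).trace ≠ 0)
    (h_cordes : coeffSq A b x / (A x).trace ^ 2 ≤ 1 / ((n : ℝ) - 1 + δ)) :
    ∑ p, cordesDev A b p x ^ 2 ≤ 1 - δ := by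
  rw [← inv_div, ← one_div] at h_cordes
  have h_le := le_of_one_div_le_one_div
    (div_pos (by positivity) (coeffSq_pos (b := b) h_trace)) h_cordes
  rw [sum_cordesDev_sq h_trace]
  linarith

end Pointwise

lemma secondOrderOp_renorm (A : (Fin n → ℝ) → Matrix (Fin n) (Fin n) ℝ)
    (b : (Fin n → ℝ) → Fin n → ℝ) (u : L2per n) (x : Fin n → ℝ) :
    secondOrderOp (renormA A b) (renormb A b) u x = renorm A b x * secondOrderOp A b u x := by
  simp only [secondOrderOp, renormA, renormb, Matrix.smul_apply, Pi.smul_apply, smul_eq_mul,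
    mul_add, Finset.mul_sum, mul_assoc]

lemma firstOrderOp_renorm_ae_eq (A : (Fin n → ℝ) → Matrix (Fin n) (Fin n) ℝ)
    (b : (Fin n → ℝ) → Fin n → ℝ) (w : Fin n → L2per n) :
    firstOrderOp (renormA A b) (renormb A b) w =ᵐ[cellMeasure n]
      fun y => divg w y + ∑ p, cordesDev A b p y * jet w p y := by
  filter_upwards [Lp.coeFn_finsetSum Finset.univ fun i => jac w i i] with y h_sum
  have h_div : divg w y = ∑ i, jac w i i y := by
    rw [← Finset.sum_apply, ← h_sum]
    rfl
  simp only [h_div, Fintype.sum_prod_type, Fintype.sum_option, cordesDev, Option.elim, jet_none,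
    jet_some, sub_mul, ite_mul, one_mul, zero_mul, firstOrderOp, Finset.sum_add_distrib,
    Finset.sum_sub_distrib, Finset.sum_ite_eq, Finset.mem_univ, if_true]
  ring

/-- Bounded coefficients satisfying the Cordes-type condition with parameter `δ`. The condition
bounds `b` by the trace of `A`, and a nonvanishing trace, as provided by ellipticity, makes the
renormalization `γ` meaningful. -/
structure IsCordesPair (δ : ℝ) (A : (Fin n → ℝ) → Matrix (Fin n) (Fin n) ℝ)
    (b : (Fin n → ℝ) → Fin n → ℝ) : Prop where
  memLp_A : ∀ i j, MemLp (fun x => A x i j) ⊤ (cellMeasure n)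
  aestronglyMeasurable_b : ∀ i, AEStronglyMeasurable (fun x => b x i) (cellMeasure n)
  trace_ne_zero : ∀ᵐ x ∂cellMeasure n, (A x).trace ≠ 0
  cordes : ∀ᵐ x ∂cellMeasure n, coeffSq A b x / (A x).trace ^ 2 ≤ 1 / ((n : ℝ) - 1 + δ)

/-- The operator `L` on jets represents `w ↦ Ã : Dw + b̃ · w`. -/
def IsRenormOp (A : (Fin n → ℝ) → Matrix (Fin n) (Fin n) ℝ) (b : (Fin n → ℝ) → Fin n → ℝ)
    (L : JetSpace n →L[ℝ] L2per n) : Prop :=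
  ∀ w : Fin n → L2per n,
    L (jet w) =ᵐ[cellMeasure n] firstOrderOp (renormA A b) (renormb A b) w

/-- The constant of Campanato nearness that the Cordes-type condition and the Poincaré inequality
provide. -/
def cordesRatio (δ : ℝ) : ℝ := √((1 - δ) * (1 + 1 / (4 * Real.pi ^ 2)))

lemma cordesRatio_lt_one {δ : ℝ} (hδ : 1 / (1 + 4 * Real.pi ^ 2) < δ) : cordesRatio δ < 1 := by
  rw [cordesRatio, Real.sqrt_lt' one_pos, one_pow]
  rw [div_lt_iff₀ (by positivity)] at hδ
  have h_eq : (1 - δ) * (1 + 1 / (4 * Real.pi ^ 2)) =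
      1 - (δ * (1 + 4 * Real.pi ^ 2) - 1) / (4 * Real.pi ^ 2) := by
    field_simp
    ring
  rw [h_eq, sub_lt_self_iff]
  exact div_pos (by linarith) (by positivity)

lemma CordesSetting.isCordesPair {A : (Fin n → ℝ) → Matrix (Fin n) (Fin n) ℝ}
    {b : (Fin n → ℝ) → Fin n → ℝ} {lam Lam δ : ℝ} (h : CordesSetting lam Lam δ A b)
    (hlam : 0 < lam) (hn : 0 < n) : IsCordesPair δ A b where
  memLp_A i j := (h.A_bounded i j).1.restrict _
  aestronglyMeasurable_b i := (h.b_bounded i).1.1.restrict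
  trace_ne_zero := by
    filter_upwards [ae_restrict_of_ae h.elliptic] with x hx
    have h_diag (i : Fin n) : lam ≤ A x i i := by simpa using (hx (Pi.single i 1)).1
    exact (Finset.sum_pos (fun i _ => hlam.trans_le (h_diag i)) ⟨⟨0, hn⟩, Finset.mem_univ _⟩).ne'
  cordes := ae_restrict_of_ae h.cordes

namespace IsCordesPair

variable {A : (Fin n → ℝ) → Matrix (Fin n) (Fin n) ℝ} {b : (Fin n → ℝ) → Fin n → ℝ} {δ : ℝ}

lemma memLp_trace (h : IsCordesPair δ A b) : MemLp (fun x => (A x).trace) ⊤ (cellMeasure n) :=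
  memLp_finsetSum _ fun i _ => h.memLp_A i i

lemma aemeasurable_renorm (h : IsCordesPair δ A b) : AEMeasurable (renorm A b) (cellMeasure n) :=
  h.memLp_trace.1.aemeasurable.div <|
    (Finset.aemeasurable_fun_sum _ fun i _ => Finset.aemeasurable_fun_sum _ fun j _ =>
      (h.memLp_A i j).1.aemeasurable.pow_const 2).add
    (Finset.aemeasurable_fun_sum _ fun i _ => (h.aestronglyMeasurable_b i).aemeasurable.pow_const 2)

lemma aemeasurable_cordesDev (h : IsCordesPair δ A b) (p : Fin n × Option (Fin n)) :
    AEMeasurable (cordesDev A b p) (cellMeasure n) := by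
  rcases p with ⟨i, _ | j⟩
  · exact h.aemeasurable_renorm.mul (h.aestronglyMeasurable_b i).aemeasurable
  · exact (h.aemeasurable_renorm.mul (h.memLp_A i j).1.aemeasurable).sub_const _

lemma ae_renorm_ne_zero (h : IsCordesPair δ A b) : ∀ᵐ x ∂cellMeasure n, renorm A b x ≠ 0 :=
  h.trace_ne_zero.mono fun _ => renorm_ne_zero

lemma ae_sum_cordesDev_sq_le (h : IsCordesPair δ A b) :
    ∀ᵐ x ∂cellMeasure n, ∑ p, cordesDev A b p x ^ 2 ≤ 1 - δ := by
  filter_upwards [h.trace_ne_zero, h.cordes] with x h_trace h_cordes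
  exact sum_cordesDev_sq_le h_trace h_cordes

lemma le_one (h : IsCordesPair δ A b) : δ ≤ 1 := by
  obtain ⟨x, hx⟩ := h.ae_sum_cordesDev_sq_le.exists
  exact sub_nonneg.1 ((Finset.sum_nonneg fun _ _ => sq_nonneg _).trans hx)

lemma memLp_cordesDev (h : IsCordesPair δ A b)
    (p : Fin n × Option (Fin n)) : MemLp (cordesDev A b p) ⊤ (cellMeasure n) := by
  refine memLp_top_of_bound (h.aemeasurable_cordesDev p).aestronglyMeasurable √(1 - δ) ?_
  filter_upwards [h.ae_sum_cordesDev_sq_le] with x hx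
  exact Real.abs_le_sqrt (le_trans (Finset.single_le_sum (f := fun p => cordesDev A b p x ^ 2)
    (fun _ _ => sq_nonneg _) (Finset.mem_univ p)) hx)

lemma memLp_inv_renorm (h : IsCordesPair δ A b) :
    MemLp (fun x => (renorm A b x)⁻¹) ⊤ (cellMeasure n) := by
  refine h.memLp_trace.of_le_mul (c := 1 / (n - 1 + δ))
    h.aemeasurable_renorm.inv.aestronglyMeasurable ?_
  filter_upwards [h.trace_ne_zero, h.cordes] with x h_trace h_cordes
  have h_eq : (renorm A b x)⁻¹ = coeffSq A b x / (A x).trace ^ 2 * (A x).trace := by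
    rw [renorm, inv_div]
    field_simp
  have h_pos := coeffSq_pos (b := b) h_trace
  rw [h_eq, norm_mul, Real.norm_of_nonneg (by positivity)]
  gcongr

lemma exists_renormOp (h : IsCordesPair δ A b) :
    ∃ L : JetSpace n →L[ℝ] L2per n, IsRenormOp A b L ∧ NearDivergence (cordesRatio δ) L := by
  obtain ⟨R, hR⟩ := exists_pairing h.memLp_cordesDev
  refine ⟨jetDiv n + R, fun w => ?_, fun w hw => ?_⟩
  · rw [add_apply, jetDiv_jet]
    filter_upwards [Lp.coeFn_add (divg w) (R (jet w)), hR (jet w),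
      firstOrderOp_renorm_ae_eq A b w] with y h_add h_R h_op
    rw [h_add, Pi.add_apply, h_R, h_op]
  · rw [add_apply, jetDiv_jet, add_sub_cancel_left]
    refine le_of_sq_le_sq ?_ (mul_nonneg (Real.sqrt_nonneg _) (jacNorm_nonneg _))
    have h_nonneg := sub_nonneg.2 h.le_one
    calc ‖R (jet w)‖ ^ 2 ≤ (1 - δ) * h1Norm w ^ 2 := by
          rw [← norm_jet]
          exact norm_sq_le_of_ae_eq_sum_mul h.ae_sum_cordesDev_sq_le (hR _)
      _ ≤ (1 - δ) * ((1 + 1 / (4 * Real.pi ^ 2)) * jacNorm w ^ 2) :=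
          mul_le_mul_of_nonneg_left (h1Norm_sq_le hw) h_nonneg
      _ = (cordesRatio δ * jacNorm w) ^ 2 := by
          rw [mul_pow, cordesRatio, Real.sq_sqrt (by positivity), mul_assoc]

end IsCordesPair

/-! ### The corrector problem -/

lemma coeFn_sub_mul_coeFn_sub {α : Type*} {mα : MeasurableSpace α} {μ : Measure α}
    (f g u v : Lp ℝ 2 μ) :
    (fun y => (f y - g y) * (u y - v y)) =ᵐ[μ] fun y => (f - g) y * (u - v) y := by
  filter_upwards [Lp.coeFn_sub f g, Lp.coeFn_sub u v] with y h_fg h_uv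
  rw [h_fg, h_uv, Pi.sub_apply, Pi.sub_apply]

lemma integral_skew_mul_skew (v w : Fin n → L2per n) :
    ∫ y in unitCell n, ∑ i, ∑ j, (jac v i j y - jac v j i y) * (jac w i j y - jac w j i y) =
      ∑ i, ∑ j, inner ℝ (jac v i j - jac v j i) (jac w i j - jac w j i) := by
  have h_int (i j : Fin n) : Integrable
      (fun y => (jac v i j y - jac v j i y) * (jac w i j y - jac w j i y)) (cellMeasure n) :=
    ((Lp.memLp _).integrable_mul (Lp.memLp _)).congr (coeFn_sub_mul_coeFn_sub _ _ _ _).symm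
  rw [integral_finsetSum _ fun i _ => integrable_finsetSum _ fun j _ => h_int i j]
  refine Finset.sum_congr rfl fun i _ => ?_
  rw [integral_finsetSum _ fun j _ => h_int i j]
  refine Finset.sum_congr rfl fun j _ => ?_
  rw [integral_congr_ae (coeFn_sub_mul_coeFn_sub _ _ _ _), integral_mul_eq_inner]

lemma neg_integral_mul_eq_inner {α : Type*} {mα : MeasurableSpace α} {μ : Measure α}
    {f : Lp ℝ 2 μ} {g : α → ℝ} (hf : f =ᵐ[μ] fun y => -g y) (u : Lp ℝ 2 μ) :
    -∫ y, g y * u y ∂μ = inner ℝ u f := by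
  rw [← integral_mul_eq_inner, ← integral_neg]
  refine integral_congr_ae ?_
  filter_upwards [hf] with y hy
  rw [hy]
  ring

namespace IsRenormOp

variable {A : (Fin n → ℝ) → Matrix (Fin n) (Fin n) ℝ} {b : (Fin n → ℝ) → Fin n → ℝ}
  {L : JetSpace n →L[ℝ] L2per n} {j : Fin n} {f χ : L2per n}

lemma apply_jet_grad (hL : IsRenormOp A b L) (hχ : χ ∈ H2per n) :
    L (jet (grad χ)) =ᵐ[cellMeasure n] secondOrderOp (renormA A b) (renormb A b) χ := by
  rw [secondOrderOp_eq_firstOrderOp_grad hχ]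
  exact hL (grad χ)

lemma B1_eq_inner (hL : IsRenormOp A b L) (φ : L2per n) (hχ : χ ∈ H2per n) :
    B1 A b φ χ = inner ℝ (lapl φ) (L (jet (grad χ))) := by
  rw [B1, ← integral_mul_eq_inner]
  refine integral_congr_ae ?_
  filter_upwards [hL.apply_jet_grad hχ] with y hy
  rw [hy]

lemma B2_eq_jetForm (hL : IsRenormOp A b L) (v w : Fin n → L2per n) :
    B2 A b v w = jetForm L (jet v) (jet w) := by
  rw [B2, jetForm_jet, integral_skew_mul_skew, ← integral_mul_eq_inner]
  congr 1
  refine integral_congr_ae ?_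
  filter_upwards [hL w] with y hy
  rw [hy]

lemma solvesB1_iff (hL : IsRenormOp A b L)
    (hf : f =ᵐ[cellMeasure n] fun y => -renormb A b y j) (hχ : χ ∈ H2per n) :
    SolvesB1 A b j χ ↔
      ∀ φ ∈ H2per0 n, inner ℝ (lapl φ) (L (jet (grad χ))) = inner ℝ (lapl φ) f := by
  simp only [SolvesB1, hL.B1_eq_inner _ hχ, neg_integral_mul_eq_inner hf]

lemma solvesB2_iff (hL : IsRenormOp A b L)
    (hf : f =ᵐ[cellMeasure n] fun y => -renormb A b y j) {S : Set (Fin n → L2per n)}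
    {ξ : Fin n → L2per n} :
    SolvesB2 A b j S ξ ↔ ∀ w ∈ S, jetForm L (jet w) (jet ξ) = inner ℝ (divg w) f := by
  simp only [SolvesB2, hL.B2_eq_jetForm, neg_integral_mul_eq_inner hf]

lemma eq_of_solvesB2 (hL : IsRenormOp A b L) {q : ℝ} (h_near : NearDivergence q L) (hq : q < 1)
    (hf : f =ᵐ[cellMeasure n] fun y => -renormb A b y j) {P : Submodule ℝ (Fin n → L2per n)}
    (hP : (P : Set (Fin n → L2per n)) ⊆ H1per0Vec n) {ξ η : Fin n → L2per n} (hξ : ξ ∈ P)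
    (hη : η ∈ P) (hBξ : SolvesB2 A b j P ξ) (hBη : SolvesB2 A b j P η) : ξ = η :=
  h_near.eq_of_jetForm_eq hq hP hξ hη fun w hw =>
    ((hL.solvesB2_iff hf).1 hBξ w hw).trans ((hL.solvesB2_iff hf).1 hBη w hw).symm

lemma solvesCorrector_iff (hL : IsRenormOp A b L)
    (hf : f =ᵐ[cellMeasure n] fun y => -renormb A b y j)
    (hγ : ∀ᵐ y ∂cellMeasure n, renorm A b y ≠ 0) (hχ : χ ∈ H2per n) :
    SolvesCorrector A b j χ ↔ L (jet (grad χ)) = f := by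
  rw [Lp.ext_iff]
  refine eventually_congr ?_
  filter_upwards [hL.apply_jet_grad hχ, hf, hγ] with y h_op h_f h_γ
  rw [h_op, h_f, secondOrderOp_renorm, renormb, Pi.smul_apply, smul_eq_mul, ← mul_neg,
    mul_right_inj' h_γ, neg_eq_iff_eq_neg]

lemma inner_eq_integral (hL : IsRenormOp A b L) (hγ : ∀ᵐ y ∂cellMeasure n, renorm A b y ≠ 0)
    {r s : L2per n} (hs : s =ᵐ[cellMeasure n] fun y => (renorm A b y)⁻¹ * r y)
    (hχ : χ ∈ H2per n) :
    inner ℝ s (L (jet (grad χ))) = ∫ y in unitCell n, r y * secondOrderOp A b χ y := by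
  rw [← integral_mul_eq_inner]
  refine integral_congr_ae ?_
  filter_upwards [hL.apply_jet_grad hχ, hs, hγ] with y h_op h_s h_γ
  rw [h_op, h_s, secondOrderOp_renorm]
  field_simp

lemma isAnnihilator (hL : IsRenormOp A b L) (hγ : ∀ᵐ y ∂cellMeasure n, renorm A b y ≠ 0)
    {r s : L2per n} (hr : IsInvariantMeasure A b r)
    (hs : s =ᵐ[cellMeasure n] fun y => (renorm A b y)⁻¹ * r y) : IsAnnihilator L s where
  ne_zero := by
    rintro rfl
    have h_zero : r =ᵐ[cellMeasure n] 0 := by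
      filter_upwards [hs, hγ, Lp.coeFn_zero ℝ 2 (cellMeasure n)] with y h_s h_γ h_zero
      rw [h_zero, Pi.zero_apply, eq_comm, mul_eq_zero] at h_s
      exact h_s.resolve_left (inv_ne_zero h_γ)
    exact zero_ne_one ((integral_eq_zero_of_ae h_zero).symm.trans hr.2)
  inner_eq_zero φ hφ := (hL.inner_eq_integral hγ hs hφ.1).trans (hr.1 φ hφ.1)

end IsRenormOp

namespace IsCordesPair

variable {A : (Fin n → ℝ) → Matrix (Fin n) (Fin n) ℝ} {b : (Fin n → ℝ) → Fin n → ℝ} {δ : ℝ}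

lemma exists_rhs (h : IsCordesPair δ A b) (j : Fin n) :
    ∃ f : L2per n, f =ᵐ[cellMeasure n] fun y => -renormb A b y j :=
  have h_mem : MemLp (fun y => -renormb A b y j) 2 (cellMeasure n) :=
    ((h.memLp_cordesDev (j, none)).mono_exponent le_top).neg
  ⟨h_mem.toLp _, h_mem.coeFn_toLp⟩

lemma exists_inv_renorm_mul (h : IsCordesPair δ A b) (r : L2per n) :
    ∃ s : L2per n, s =ᵐ[cellMeasure n] fun y => (renorm A b y)⁻¹ * r y :=
  have h_mem : MemLp (fun y => (renorm A b y)⁻¹ * r y) 2 (cellMeasure n) :=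
    (Lp.memLp r).mul h.memLp_inv_renorm
  ⟨h_mem.toLp _, h_mem.coeFn_toLp⟩

lemma inner_rhs_eq_zero (h : IsCordesPair δ A b) {r f s : L2per n} {j : Fin n}
    (hs : s =ᵐ[cellMeasure n] fun y => (renorm A b y)⁻¹ * r y)
    (hf : f =ᵐ[cellMeasure n] fun y => -renormb A b y j)
    (h_centered : ∫ y in unitCell n, b y j * r y = 0) : inner ℝ s f = 0 := by
  rw [← neg_integral_mul_eq_inner hf, neg_eq_zero, ← h_centered]
  refine integral_congr_ae ?_
  filter_upwards [hs, h.ae_renorm_ne_zero] with y h_s h_γ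
  rw [h_s, renormb, Pi.smul_apply, smul_eq_mul]
  field_simp

end IsCordesPair

lemma one_div_lt_of_div_lt {δ : ℝ} (hn : 1 ≤ n) (hδ : (n : ℝ) / (n + Real.pi ^ 2) < δ) :
    1 / (1 + 4 * Real.pi ^ 2) < δ := by
  refine lt_of_le_of_lt ?_ hδ
  have hn' : (1 : ℝ) ≤ n := by exact_mod_cast hn
  rw [div_le_div_iff₀ (by positivity) (by positivity)]
  nlinarith [sq_nonneg Real.pi]

end PeriodicCorrector

end

open PeriodicCorrector in
theorem theorem4p3_general {δ : ℝ} (hδ : 1 / (1 + 4 * Real.pi ^ 2) < δ) :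
    ∃ C : ℝ, 0 < C ∧
      ∀ (n : ℕ) (A : (Fin n → ℝ) → Matrix (Fin n) (Fin n) ℝ) (b : (Fin n → ℝ) → Fin n → ℝ),
        IsCordesPair δ A b → ∀ r : L2per n, IsInvariantMeasure A b r →
      ∀ j : Fin n, ∫ y in unitCell n, b y j * r y = 0 →
        ∃ χ : L2per n,
          (χ ∈ H2per0 n ∧ SolvesB1 A b j χ) ∧
          (∀ v ∈ H2per0 n, SolvesB1 A b j v → v = χ) ∧
          SolvesCorrector A b j χ ∧
          (∀ v ∈ H2per0 n, SolvesCorrector A b j v → v = χ) ∧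
          (grad χ ∈ H1per0Vec n ∧ SolvesB2 A b j (H1per0Vec n) (grad χ)) ∧
          (∀ ξ ∈ H1per0Vec n, SolvesB2 A b j (H1per0Vec n) ξ → ξ = grad χ) ∧
          ∀ P : Submodule ℝ (Fin n → L2per n), IsClosedSubspace P →
            ∃ ξh : Fin n → L2per n,
              (ξh ∈ P ∧ SolvesB2 A b j P ξh) ∧
              (∀ η ∈ P, SolvesB2 A b j P η → η = ξh) ∧
              h1Norm (grad χ - ξh) ≤
                C * ⨅ w : P, jacNorm (grad χ - (w : Fin n → L2per n)) := by
  have hq := cordesRatio_lt_one hδ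
  have hq₀ : 0 ≤ cordesRatio δ := Real.sqrt_nonneg _
  refine ⟨√(1 + 1 / (4 * Real.pi ^ 2)) * ((1 + cordesRatio δ) / (1 - cordesRatio δ)),
    mul_pos (by positivity) (div_pos (by positivity) (sub_pos.2 hq)), ?_⟩
  intro n A b h r hr j h_centered
  obtain ⟨L, hL, h_near⟩ := h.exists_renormOp
  obtain ⟨f, hf⟩ := h.exists_rhs j
  obtain ⟨s, hs⟩ := h.exists_inv_renorm_mul r
  have hγ := h.ae_renorm_ne_zero
  have h_ann := hL.isAnnihilator hγ hr hs
  have h_inner := h.inner_rhs_eq_zero hs hf h_centered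
  obtain ⟨χ, hχ, hχf⟩ := h_near.exists_apply_jet_grad_eq hq h_ann h_inner
  have h_unique (v : L2per n) (hv : v ∈ H2per0 n) (hvf : L (jet (grad v)) = f) : v = χ :=
    h_near.eq_of_apply_jet_grad_eq hq hv hχ (hvf.trans hχf.symm)
  have h_form (w : Fin n → L2per n) : jetForm L (jet w) (jet (grad χ)) = inner ℝ (divg w) f := by
    rw [jetForm_jet_grad L w hχ.1, hχf]
  have h_grad := grad_mem_H1per0Vec hχ.1
  have hB2 (S) : SolvesB2 A b j S (grad χ) := (hL.solvesB2_iff hf).2 fun w _ => h_form w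
  refine ⟨χ, ⟨hχ, (hL.solvesB1_iff hf hχ.1).2 fun φ _ => by rw [hχf]⟩,
    fun v hv hB => h_unique v hv (h_near.eq_of_inner_lapl_eq hq h_ann h_inner hv
      ((hL.solvesB1_iff hf hv.1).1 hB)),
    (hL.solvesCorrector_iff hf hγ hχ.1).2 hχf,
    fun v hv hv' => h_unique v hv ((hL.solvesCorrector_iff hf hγ hv.1).1 hv'),
    ⟨h_grad, hB2 _⟩, fun ξ hξ hB => hL.eq_of_solvesB2 h_near hq hf (P := h1per0Vec n) subset_rfl
      hξ h_grad hB (hB2 _), fun P hP => ?_⟩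
  obtain ⟨ξh, hξh, h_galerkin⟩ := h_near.exists_jetForm_eq hq hP f
  have hBh := (hL.solvesB2_iff hf).2 h_galerkin
  exact ⟨ξh, ⟨hξh, hBh⟩, fun η hη hB => hL.eq_of_solvesB2 h_near hq hf hP.1 hη hξh hB hBh,
    h_near.h1Norm_sub_le hq₀ hq hP.1 h_grad hξh fun w hw => (h_form w).trans (h_galerkin w hw).symm⟩

theorem theorem4p3 (n : ℕ) (lam Lam δ : ℝ) (hlam : 0 < lam) (hLam : 0 < Lam)
    (hδ : (n : ℝ) / (n + Real.pi ^ 2) < δ) (hδ1 : δ ≤ 1) :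
    ∃ C : ℝ, 0 < C ∧
      ∀ (A : (Fin n → ℝ) → Matrix (Fin n) (Fin n) ℝ) (b : (Fin n → ℝ) → Fin n → ℝ),
        PeriodicCorrector.CordesSetting lam Lam δ A b →
      ∀ r : PeriodicCorrector.L2per n, PeriodicCorrector.IsInvariantMeasure A b r →
        (∀ i, ∫ y in PeriodicCorrector.unitCell n, b y i * r y = 0) →
      ∀ j : Fin n,
        ∃ χ : PeriodicCorrector.L2per n,
          (χ ∈ PeriodicCorrector.H2per0 n ∧ PeriodicCorrector.SolvesB1 A b j χ) ∧
          (∀ v ∈ PeriodicCorrector.H2per0 n, PeriodicCorrector.SolvesB1 A b j v → v = χ) ∧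
          PeriodicCorrector.SolvesCorrector A b j χ ∧
          (∀ v ∈ PeriodicCorrector.H2per0 n, PeriodicCorrector.SolvesCorrector A b j v → v = χ) ∧
          (PeriodicCorrector.grad χ ∈ PeriodicCorrector.H1per0Vec n ∧
            PeriodicCorrector.SolvesB2 A b j (PeriodicCorrector.H1per0Vec n)
              (PeriodicCorrector.grad χ)) ∧
          (∀ ξ ∈ PeriodicCorrector.H1per0Vec n,
            PeriodicCorrector.SolvesB2 A b j (PeriodicCorrector.H1per0Vec n) ξ →
              ξ = PeriodicCorrector.grad χ) ∧
          ∀ P : Submodule ℝ (Fin n → PeriodicCorrector.L2per n),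
            PeriodicCorrector.IsClosedSubspace P →
            ∃ ξh : Fin n → PeriodicCorrector.L2per n,
              (ξh ∈ P ∧ PeriodicCorrector.SolvesB2 A b j P ξh) ∧
              (∀ η ∈ P, PeriodicCorrector.SolvesB2 A b j P η → η = ξh) ∧
              PeriodicCorrector.h1Norm (PeriodicCorrector.grad χ - ξh) ≤
                C * ⨅ w : P, PeriodicCorrector.jacNorm
                  (PeriodicCorrector.grad χ - (w : Fin n → PeriodicCorrector.L2per n)) := by
  rcases Nat.eq_zero_or_pos n with rfl | hn
  · exact ⟨1, one_pos, fun _ _ _ _ _ _ j => j.elim0⟩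
  · obtain ⟨C, hC, h⟩ := theorem4p3_general (PeriodicCorrector.one_div_lt_of_div_lt hn hδ)
    exact ⟨C, hC, fun A b hAb r hr h_centered j =>
      h n A b (hAb.isCordesPair hlam hn) r hr j (h_centered j)⟩
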